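/- Let $\kappa>0$, $\mu\ge 0$, $r>0$, let $k:\mathbb R^2\to[0,\infty)$ be an even (for instance radial) probability density with $k(z)=0$ for $\|z\|>r$, and let $p:\mathbb R^2\to[0,1]$ be measurable. Let $\Psi$ be a homogeneous Poisson process on $\mathbb R^2$ with intensity $\kappa$ (the parents). Each parent $y$ independently has a Poisson($\mu$) number of offspring, placed independently at $y+Z$, where $Z$ has density $k$; each offspring point at $x$ is retained, independently of everything else, with probability $p(x)$. Let $\Phi$ be the process of all retained offspring points. Let $W\subseteq\mathbb R^2$ be a measurable window, let $W_{\oplus r}$ be the Minkowski sum of $W$ and the closed disc of radius $r$ about $0$, let $\partial W=W_{\oplus r}\setminus W$ (assumed measurable, as it is for closed or open $W$), and write $\Phi_W$, $\Psi_{W\cup\partial W}$ for the restrictions of $\Phi$, $\Psi$ to $W$, $W\cup\partial W$. Let $b(x,r)$ be the closed disc of centre $x$ and radius $r$. For a point process $\eta$ and a measurable set $D$, a conditional intensity of $\eta$ on $D$ given $\Phi_W$ is a $[0,\infty]$-valued function $\lambda(x\mid\varphi)$ of $x\in D$ and of the configuration $\varphi$, measurable with respect to the completion of the product of the law of $\Phi_W$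 and Lebesgue measure, such that $\mathbb E[\eta(B)\mid\Phi_W]=\int_B\lambda(x\mid\Phi_W)\,dx$ almost surely for every Borel set $B\subseteq D$. Then a regular conditional law $\mathbb P[\Psi_{W\cup\partial W}\mid\Phi_W]$ exists, and for every version of it the function $$\lambda(x_o\mid\Phi_W)=\int\Big[\sum_{y\in\Psi_{W\cup\partial W}}\mu\,p(x_o)\,k(y-x_o)+\mu\kappa\int_{b(x_o,r)\setminus(W\cup\partial W)}p(x_o)\,k(y-x_o)\,dy\Big]\,d\mathbb P[\Psi_{W\cup\partial W}\mid\Phi_W],\qquad x_o\in\mathbb R^2\setminus W,$$ is a conditional intensity of $\Phi$ on $\mathbb R^2\setminus W$ given $\Phi_W$; any other conditional intensity agrees with it for almost every realization of $\Phi_W$ and Lebesgue-almost every $x_o\notin W$. Moreover, a conditional intensity $\rho(y\mid\Phi_W)$ of $\Psi$ on $W\cup\partial W$ given $\Phi_W$ exists, and for every such $\rho$, almost surely, for all $x_o$ simultaneously, $$\int\sum_{y\in\Psi_{W\cup\partial W}}\mu\,p(x_o)\,k(y-x_o)\,d\mathbb P[\Psi_{W\cup\partial W}\mid\Phi_W]=\int_{W\cup\partial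 W}\mu\,p(x_o)\,k(y-x_o)\,\rho(y\mid\Phi_W)\,dy,$$ so that $$\int_{W\cup\partial W}\mu\,p(x_o)\,k(y-x_o)\,\rho(y\mid\Phi_W)\,dy+\mu\kappa\int_{b(x_o,r)\setminus(W\cup\partial W)}p(x_o)\,k(y-x_o)\,dy$$ is a conditional intensity of $\Phi$ on $\mathbb R^2\setminus W$ given $\Phi_W$ as well. -/

import Mathlib

open MeasureTheory ProbabilityTheory Set
open scoped ENNReal NNReal Pointwise

noncomputable section

namespace ClusterProcess

/-- The Euclidean plane `ℝ²`. -/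
abbrev Plane : Type := EuclideanSpace ℝ (Fin 2)

/-- A random measure `η` on the plane is a Poisson process with intensity measure `Λ`: the
number of points in a Borel set `B` with `Λ B < ∞` is Poisson with mean `Λ B`, and the numbers
of points in disjoint Borel sets are independent. -/
structure IsPoissonProcess {Ω : Type*} [MeasurableSpace Ω] (P : Measure Ω)
    (Λ : Measure Plane) (η : Ω → Measure Plane) : Prop where
  measurable : Measurable η
  count_law : ∀ B : Set Plane, MeasurableSet B → Λ B ≠ ∞ →
    P.map (fun ω => η ω B) = (poissonMeasure (Λ B).toNNReal).map (fun n : ℕ => (n : ℝ≥0∞))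
  count_indep : ∀ (n : ℕ) (B : Fin n → Set Plane), (∀ i, MeasurableSet (B i)) →
    Pairwise (fun i j => Disjoint (B i) (B j)) → iIndepFun (fun i ω => η ω (B i)) P

/-- The parent process: one unit mass at each of the points `parent i`. -/
def parentProcess {Ω : Type*} (parent : ℕ → Ω → Plane) (ω : Ω) : Measure Plane :=
  Measure.sum fun i => Measure.dirac (parent i ω)

/-- The thinned cluster process. Parent `i` has `number i` offspring, the `j`-th of them
(`j < number i`) located at `parent i + shift i j`; an offspring point at `x` is retained when
its mark `mark i j`, uniform on `[0, 1]`, is at most `p x`, i.e. with probability `p x`. The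
process consists of all retained offspring points, regardless of their parentage. -/
def thinnedProcess {Ω : Type*} (p : Plane → ℝ≥0) (parent : ℕ → Ω → Plane) (number : ℕ → Ω → ℕ)
    (shift : ℕ → ℕ → Ω → Plane) (mark : ℕ → ℕ → Ω → ℝ) (ω : Ω) : Measure Plane :=
  Measure.sum fun q : ℕ × ℕ =>
    if q.2 < number q.1 ω ∧ mark q.1 q.2 ω ≤ p (parent q.1 ω + shift q.1 q.2 ω) then
      Measure.dirac (parent q.1 ω + shift q.1 q.2 ω)
    else 0

/-- The random ingredients of a thinned Neyman–Scott process with parent intensity `κ`, mean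
cluster size `μ` and dispersion density `k`: homogeneous Poisson parents, Poisson numbers of
offspring, displacements with density `k`, uniform thinning marks, everything independent. -/
structure IsNeymanScott {Ω : Type*} [MeasurableSpace Ω] (P : Measure Ω) (κ μ : ℝ≥0)
    (k : Plane → ℝ≥0) (parent : ℕ → Ω → Plane) (number : ℕ → Ω → ℕ)
    (shift : ℕ → ℕ → Ω → Plane) (mark : ℕ → ℕ → Ω → ℝ) : Prop where
  measurable_parent : ∀ i, Measurable (parent i)
  measurable_number : ∀ i, Measurable (number i)
  measurable_shift : ∀ i j, Measurable (shift i j)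
  measurable_mark : ∀ i j, Measurable (mark i j)
  /-- The parents form a homogeneous Poisson process with intensity `κ`. -/
  parent_law : IsPoissonProcess P ((κ : ℝ≥0∞) • (volume : Measure Plane)) (parentProcess parent)
  /-- The number of offspring of each parent is Poisson with mean `μ`. -/
  number_law : ∀ i, P.map (number i) = poissonMeasure μ
  /-- The displacement from parent to offspring has density `k`. -/
  shift_law : ∀ i j, P.map (shift i j) = volume.withDensity (fun z => (k z : ℝ≥0∞))
  /-- The thinning marks are uniform on `[0, 1]`. -/
  mark_law : ∀ i j, P.map (mark i j) = volume.restrict (Icc (0 : ℝ) 1)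
  number_indep : iIndepFun number P
  shift_indep : iIndepFun (fun q : ℕ × ℕ => shift q.1 q.2) P
  mark_indep : iIndepFun (fun q : ℕ × ℕ => mark q.1 q.2) P
  /-- Numbers, displacements and marks are independent of the parents. -/
  parent_indep : IndepFun (fun ω i => parent i ω)
    (fun ω => ((fun i => number i ω), (fun i j => shift i j ω), (fun i j => mark i j ω))) P
  /-- Displacements and marks are independent of the numbers of offspring. -/
  number_indep_rest : IndepFun (fun ω i => number i ω)
    (fun ω => ((fun i j => shift i j ω), (fun i j => mark i j ω))) P
  /-- Displacements are independent of the marks. -/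
  shift_indep_mark : IndepFun (fun ω i j => shift i j ω) (fun ω i j => mark i j ω) P

/-- The border `∂W = W_{⊕r} \ W`, where `W_{⊕r}` is the Minkowski sum of `W` and the closed
disc of radius `r`. -/
def border (W : Set Plane) (r : ℝ) : Set Plane :=
  (W + Metric.closedBall (0 : Plane) r) \ W

/-- `lam z x` is (a version of) the conditional intensity at `x ∈ D` of the point process `η`
given the random element `Z = z`: for every Borel set `B ⊆ D`,
`E[η(B) | Z] = ∫_B lam(Z, x) dx`, i.e. both sides have the same integral over every event
`{Z ∈ F}`. -/
def IsConditionalIntensity {Ω T : Type*} [MeasurableSpace Ω] [MeasurableSpace T]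
    (P : Measure Ω) (η : Ω → Measure Plane) (Z : Ω → T) (D : Set Plane)
    (lam : T → Plane → ℝ≥0∞) : Prop :=
  AEMeasurable (fun q : T × Plane => lam q.1 q.2) ((P.map Z).prod (volume.restrict D)) ∧
  ∀ B : Set Plane, MeasurableSet B → B ⊆ D → ∀ F : Set T, MeasurableSet F →
    ∫⁻ ω in Z ⁻¹' F, η ω B ∂P = ∫⁻ ω in Z ⁻¹' F, (∫⁻ x in B, lam (Z ω) x) ∂P

/-- `∑_{y ∈ ψ ∩ A} μ p(x) k(y - x)`, the sum being over the points of the configuration `ψ`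
(a counting measure) in `A`. -/
def parentSum (μ : ℝ≥0) (k p : Plane → ℝ≥0) (A : Set Plane) (ψ : Measure Plane) (x : Plane) :
    ℝ≥0∞ :=
  ∫⁻ y in A, (μ : ℝ≥0∞) * p x * k (y - x) ∂ψ

/-- `μ κ ∫_{b(x, r) \ A} p(x) k(y - x) dy`. -/
def outerTerm (κ μ : ℝ≥0) (k p : Plane → ℝ≥0) (r : ℝ) (A : Set Plane) (x : Plane) : ℝ≥0∞ :=
  (μ : ℝ≥0∞) * κ * ∫⁻ y in Metric.closedBall x r \ A, (p x : ℝ≥0∞) * k (y - x)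

end ClusterProcess

end

/-! Write `Z` for `Φ_W` and `A` for `W ∪ ∂W`. A conditional intensity of `η` given `Z` is a density,
with respect to the law of `Z` times Lebesgue measure, of the Campbell measure `F × B ↦ E[1_F(Z)
η(B)]` (`isConditionalIntensity_iff`). Uniqueness is uniqueness of densities. Campbell measures are
compared through Laplace functionals: the law of `Z` weighted by an integrable `X ≥ 0` is determined
by the numbers `E[e^{-∫u dZ} X]` (`setLIntegral_preimage_eq_of_laplace`).

For `u` vanishing off `W` put `v(y) = μ ∫ p(x) k(x-y) (1 - e^{-u(x)}) dx`, and for `B` disjoint from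
`W` put `w(y) = μ ∫_B p(x) k(x-y) dx`. Integrating out the clusters with the parents fixed turns
`e^{-∫u dZ}` into `e^{-∫v dΨ}` and the extra factor `Φ(B)` into `∫ w dΨ`. The Mecke equation gives
`E[e^{-∫v dΨ} ∫ w dΨ] = E[e^{-∫v dΨ}] κ ∫ e^{-v} w`. Parents outside `A` cannot reach `W`, so `v =
0` there and the part of the integral off `A` is `κ ∫ w`; on `A` the Mecke equation is read
backwards and returns `∫_A w dΨ`. This is `setLIntegral_thinnedProcess`; Tonelli rewrites `w` as an
integral over `x ∈ B` and yields the formula.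

The mean measure of the conditional law has density `ρ` on `A`, outside a single null set of
observations (`join_restrict_eq_withDensity`); hence the rewriting through `ρ` holds for all `x_o`
at once.

For the existence of `ρ`, the Mecke equation identifies the Campbell measure of the parents as the
image of `P ⊗ P ⊗ κ dy` on `A` under `(Z + independent cluster at y, y)` (`jointLaw_cluster_apply`).
Displacements have a density, so one measure dominates the laws of `Z + cluster at y` for all `y`.
Moreover the first marginal of a Campbell measure is always dominated by the law of `Z`. Together
these give absolute continuity with respect to the product (`absolutelyContinuous_prod_of_fst`), and
Radon–Nikodym applies. -/

noncomputable section

namespace ClusterProcess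

open Filter Topology

/-! ### Laplace functionals determine laws of random measures. -/

section

/-- The function `x ↦ e^{-x}` on `[0, ∞]`. -/
def expNeg (x : ℝ≥0∞) : ℝ≥0∞ := EReal.exp (-(x : EReal))

@[simp] lemma expNeg_zero : expNeg 0 = 1 := by simp [expNeg]

lemma expNeg_coe (x : ℝ≥0) : expNeg x = ENNReal.ofReal (Real.exp (-x)) := by
  have : (-(((x : ℝ≥0∞)) : EReal)) = ((-(x : ℝ) : ℝ) : EReal) := by
    rw [EReal.coe_neg]; rfl
  rw [expNeg, this, EReal.exp_coe]

lemma expNeg_add (x y : ℝ≥0∞) : expNeg (x + y) = expNeg x * expNeg y := by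
  rw [expNeg, expNeg, expNeg, ← EReal.exp_add, EReal.coe_ennreal_add, EReal.neg_add, sub_eq_add_neg]
  · exact Or.inl (EReal.coe_ennreal_ne_bot x)
  · exact Or.inr (EReal.coe_ennreal_ne_bot y)

lemma expNeg_le_one (x : ℝ≥0∞) : expNeg x ≤ 1 := by
  rw [expNeg, EReal.exp_le_one_iff, EReal.neg_le, neg_zero]
  exact EReal.coe_ennreal_nonneg x

lemma expNeg_ne_top (x : ℝ≥0∞) : expNeg x ≠ ∞ := ((expNeg_le_one x).trans_lt ENNReal.one_lt_top).ne

lemma expNeg_strictAnti : StrictAnti expNeg := fun x y h => by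
  rw [expNeg, expNeg, EReal.exp_lt_exp_iff, EReal.neg_lt_neg_iff, EReal.coe_ennreal_lt_coe_ennreal_iff]
  exact h

@[fun_prop]
lemma continuous_expNeg : Continuous expNeg :=
  ENNReal.continuous_exp.comp (continuous_neg.comp continuous_coe_ennreal_ereal)

@[fun_prop]
lemma measurable_expNeg : Measurable expNeg := continuous_expNeg.measurable

lemma expNeg_sum {ι : Type*} (s : Finset ι) (f : ι → ℝ≥0∞) :
    expNeg (∑ i ∈ s, f i) = ∏ i ∈ s, expNeg (f i) := by
  classical
  induction s using Finset.induction_on with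
  | empty => simp
  | insert i s hi ih => rw [Finset.sum_insert hi, Finset.prod_insert hi, expNeg_add, ih]

lemma expNeg_nat_mul (n : ℕ) (x : ℝ≥0∞) : expNeg (n * x) = expNeg x ^ n := by
  have := expNeg_sum (Finset.range n) (fun _ => x)
  simpa using this

/-- Finite measures on a finite power of the unit interval are determined by their mixed
moments. -/
lemma ext_of_moments {ι : Type*} [Fintype ι] (P Q : Measure (ι → unitInterval))
    [IsFiniteMeasure P] [IsFiniteMeasure Q]
    (h : ∀ m : ι → ℕ, ∫ x, ∏ i, (x i : ℝ) ^ m i ∂P = ∫ x, ∏ i, (x i : ℝ) ^ m i ∂Q) : P = Q := by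
  classical
  let c : ι → BoundedContinuousFunction (ι → unitInterval) ℝ := fun i =>
    BoundedContinuousFunction.mkOfCompact ⟨fun x => (x i : ℝ), by fun_prop⟩
  let A : StarSubalgebra ℝ (BoundedContinuousFunction (ι → unitInterval) ℝ) :=
    { Algebra.adjoin ℝ (range c) with
      star_mem' := by
        intro a ha
        have : star a = a := by ext x; simp
        rwa [this] }
  refine ext_of_forall_mem_subalgebra_integral_eq_of_polish (𝕜 := ℝ) (A := A) ?_ ?_
  · intro x y hxy
    obtain ⟨i, hi⟩ := Function.ne_iff.1 hxy
    refine ⟨_, ⟨_, ⟨c i, ?_, rfl⟩, rfl⟩, ?_⟩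
    · exact Algebra.subset_adjoin (mem_range_self i)
    · exact fun h => hi (Subtype.ext h)
  · intro g hg
    change g ∈ Algebra.adjoin ℝ (range c) at hg
    -- The algebra generated by the coordinates is the linear span of the monomials, and it
    -- separates points.
    rw [← Subalgebra.mem_toSubmodule, Algebra.adjoin_eq_span] at hg
    induction hg using Submodule.span_induction with
    | mem g hg =>
      have : ∃ m : ι → ℕ, ∀ x, g x = ∏ i, (x i : ℝ) ^ m i := by
        induction hg using Submonoid.closure_induction with
        | mem g hg =>
          obtain ⟨i, rfl⟩ := hg
          refine ⟨Pi.single i 1, fun x => ?_⟩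
          rw [Finset.prod_eq_single i]
          · simp [c]
          · intro j _ hj
            simp [Pi.single_eq_of_ne hj]
          · simp
        | one => exact ⟨0, fun x => by simp⟩
        | mul f g _ _ hf hg =>
          obtain ⟨m, hm⟩ := hf
          obtain ⟨n, hn⟩ := hg
          exact ⟨m + n, fun x => by simp [hm, hn, pow_add, Finset.prod_mul_distrib]⟩
      obtain ⟨m, hm⟩ := this
      simp_rw [hm]
      exact h m
    | zero => simp
    | add f g _ _ hf hg =>
      simp only [BoundedContinuousFunction.coe_add, Pi.add_apply]
      rw [integral_add (f.integrable P) (g.integrable P), integral_add (f.integrable Q)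
        (g.integrable Q), hf, hg]
    | smul a f _ hf =>
      simp only [BoundedContinuousFunction.coe_smul, integral_const_mul, smul_eq_mul, hf]

/-- Finite measures on the space of measures are determined by their Laplace functionals. -/
lemma ext_of_laplace {α : Type*} [MeasurableSpace α] (P Q : Measure (Measure α))
    [IsFiniteMeasure P] [IsFiniteMeasure Q]
    (h : ∀ u : α → ℝ≥0∞, Measurable u → (∀ x, u x ≠ ∞) →
      ∫⁻ η, expNeg (∫⁻ x, u x ∂η) ∂P = ∫⁻ η, expNeg (∫⁻ x, u x ∂η) ∂Q) : P = Q := by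
  classical
  -- The test functions `∑ m_B 1_B` turn the Laplace functional into the mixed moments of the
  -- variables `e^{-η(B)}`, which lie in `[0, 1]`.
  have hlap : ∀ (t : Finset {B : Set α // MeasurableSet B}) (m : t → ℕ) (η : Measure α),
      ∏ B : t, expNeg (η B.1.1) ^ m B =
        expNeg (∫⁻ x, ∑ B : t, (m B : ℝ≥0∞) * B.1.1.indicator 1 x ∂η) := by
    intro t m η
    rw [lintegral_finsetSum _ fun B _ => (measurable_one.indicator B.1.2).const_mul _, expNeg_sum]
    refine Finset.prod_congr rfl fun B _ => ?_
    rw [lintegral_const_mul _ (measurable_one.indicator B.1.2), lintegral_indicator_one B.1.2,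
      expNeg_nat_mul]
  let G : ∀ t : Finset {B : Set α // MeasurableSet B}, Measure α → t → unitInterval :=
    fun t η B => ⟨(expNeg (η B.1.1)).toReal, ENNReal.toReal_nonneg, by
      simpa using ENNReal.toReal_mono ENNReal.one_ne_top (expNeg_le_one (η B.1.1))⟩
  have hG : ∀ t, Measurable (G t) := fun t => by
    refine measurable_pi_lambda _ fun B => Measurable.subtype_mk ?_
    exact (measurable_expNeg.comp (Measure.measurable_coe B.1.2)).ennreal_toReal
  have hmap : ∀ t, P.map (G t) = Q.map (G t) := by
    intro t
    refine ext_of_moments _ _ fun m => ?_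
    have key : ∀ ν : Measure (Measure α), ∫ x, ∏ i, (x i : ℝ) ^ m i ∂(ν.map (G t)) =
        (∫⁻ η, expNeg (∫⁻ x, ∑ B : t, (m B : ℝ≥0∞) * B.1.1.indicator 1 x ∂η) ∂ν).toReal := by
      intro ν
      rw [integral_map (hG t).aemeasurable (by
        refine Continuous.aestronglyMeasurable ?_; fun_prop)]
      simp_rw [← hlap]
      rw [← integral_toReal]
      · simp [G, ENNReal.toReal_prod]
      · exact (Finset.measurable_prod _ fun B _ =>
          (measurable_expNeg.comp (Measure.measurable_coe B.1.2)).pow_const _).aemeasurable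
      · exact ae_of_all _ fun η => ENNReal.prod_lt_top fun B _ =>
          ENNReal.pow_lt_top (expNeg_ne_top _).lt_top
    rw [key, key, h]
    · exact Finset.measurable_sum _ fun B _ => (measurable_one.indicator B.1.2).const_mul _
    · intro x
      refine ENNReal.sum_ne_top.2 fun B _ => ENNReal.mul_ne_top (by simp) ?_
      by_cases hx : x ∈ B.1.1 <;> simp [hx]
  let π : {B : Set α // MeasurableSet B} → Set (Set (Measure α)) := fun B =>
    {s | MeasurableSet[MeasurableSpace.comap (fun η : Measure α => η B.1) inferInstance] s}
  have hgen : (inferInstance : MeasurableSpace (Measure α)) =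
      MeasurableSpace.generateFrom (piiUnionInter π univ) := by
    rw [generateFrom_piiUnionInter_measurableSet (fun B : {B : Set α // MeasurableSet B} =>
      MeasurableSpace.comap (fun η : Measure α => η B.1) inferInstance)]
    simp only [mem_univ, iSup_pos]
    exact iSup_subtype'
  refine ext_of_generate_finite _ hgen
    (isPiSystem_piiUnionInter _ (fun B => @MeasurableSpace.isPiSystem_measurableSet _ (_)) _) ?_ ?_
  · rintro s ⟨t, -, f, hf, rfl⟩
    choose! S hS hSf using hf
    -- Since `expNeg` is injective on all of `[0, ∞]`, with `e^{-∞} = 0`, every event about `η(B)`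
    -- is an event about `e^{-η(B)}`; images of measurable sets under it are measurable.
    have hs : (⋂ B ∈ t, f B) = G t ⁻¹'
        (⋂ B : t, (fun x => x B) ⁻¹' ((fun y : unitInterval => ENNReal.ofReal y) ⁻¹' (expNeg '' S B))) := by
      ext η
      simp only [mem_iInter, mem_preimage, G, ENNReal.ofReal_toReal (expNeg_ne_top _),
        expNeg_strictAnti.injective.mem_set_image, Subtype.forall]
      refine forall₂_congr fun B hmB => forall_congr' fun hB => ?_
      rw [← hSf ⟨B, hmB⟩ hB]
      rfl
    have hms : MeasurableSet (⋂ B : t, (fun x : t → unitInterval => x B) ⁻¹'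
        ((fun y : unitInterval => ENNReal.ofReal y) ⁻¹' (expNeg '' S B))) := by
      refine MeasurableSet.iInter fun B => measurable_pi_apply B ?_
      refine (ENNReal.measurable_ofReal.comp measurable_subtype_coe) ?_
      exact (hS B B.2).image_of_measurable_injOn measurable_expNeg expNeg_strictAnti.injective.injOn
    rw [hs, ← Measure.map_apply (hG t) hms, ← Measure.map_apply (hG t) hms, hmap]
  · simpa using h 0 measurable_zero (by simp)

end

/-! ### Independent families and exponentials of infinite sums. -/

section

section Independence

variable {Ω ι : Type*} [MeasurableSpace Ω] {P : Measure Ω}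

/-- It suffices to test on rectangles, a π-system: independence of the two families splits off the
`g`-part, after which each family factorises by itself. -/
lemma iIndepFun_prodMk {E F : ι → Type*} [∀ i, MeasurableSpace (E i)]
    [∀ i, MeasurableSpace (F i)] {f : ∀ i, Ω → E i} {g : ∀ i, Ω → F i}
    (hf : ∀ i, Measurable (f i)) (hg : ∀ i, Measurable (g i))
    (hfi : iIndepFun f P) (hgi : iIndepFun g P)
    (hfg : IndepFun (fun ω i => f i ω) (fun ω i => g i ω) P) :
    iIndepFun (fun i ω => (f i ω, g i ω)) P := by
  have h2 : ∀ i, IndepFun (f i) (g i) P := fun i =>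
    hfg.comp (measurable_pi_apply i) (measurable_pi_apply i)
  let π : ι → Set (Set Ω) := fun i =>
    {s | ∃ A B, MeasurableSet A ∧ MeasurableSet B ∧ s = f i ⁻¹' A ∩ g i ⁻¹' B}
  refine iIndepSets.iIndep (fun i => ((hf i).prodMk (hg i)).comap_le) π ?_ ?_ ?_
  · rintro i _ ⟨A, B, hA, hB, rfl⟩ _ ⟨A', B', hA', hB', rfl⟩ -
    exact ⟨A ∩ A', B ∩ B', hA.inter hA', hB.inter hB', by ext; simp; tauto⟩
  · intro i
    change MeasurableSpace.comap _ Prod.instMeasurableSpace = _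
    rw [← generateFrom_prod, MeasurableSpace.comap_generateFrom]
    congr 1
    ext s
    constructor
    · rintro ⟨_, ⟨A, hA, B, hB, rfl⟩, rfl⟩
      exact ⟨A, B, hA, hB, rfl⟩
    · rintro ⟨A, B, hA, hB, rfl⟩
      exact ⟨_, ⟨A, hA, B, hB, rfl⟩, rfl⟩
  · rw [iIndepSets_iff]
    intro S s hs
    choose! A B hA hB hAB using hs
    have hset : ⋂ i ∈ S, s i = (fun ω i => f i ω) ⁻¹' (⋂ i ∈ S, (fun x => x i) ⁻¹' A i) ∩
        (fun ω i => g i ω) ⁻¹' (⋂ i ∈ S, (fun x => x i) ⁻¹' B i) := by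
      ext ω
      simp only [mem_iInter, mem_inter_iff, mem_preimage]
      constructor
      · intro h
        exact ⟨fun i hi => by have := h i hi; rw [hAB i hi] at this; exact this.1,
          fun i hi => by have := h i hi; rw [hAB i hi] at this; exact this.2⟩
      · rintro ⟨h1, h2⟩ i hi
        rw [hAB i hi]
        exact ⟨h1 i hi, h2 i hi⟩
    rw [hset, hfg.measure_inter_preimage_eq_mul _ _
      (S.measurableSet_biInter fun i hi => measurable_pi_apply i (hA i hi))
      (S.measurableSet_biInter fun i hi => measurable_pi_apply i (hB i hi))]
    simp only [preimage_iInter, preimage_preimage]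
    rw [hfi.measure_inter_preimage_eq_mul S hA, hgi.measure_inter_preimage_eq_mul S hB,
      ← Finset.prod_mul_distrib]
    refine Finset.prod_congr rfl fun i hi => ?_
    rw [hAB i hi, (h2 i).measure_inter_preimage_eq_mul _ _ (hA i hi) (hB i hi)]

/-- Independence means that the joint law is an infinite product, and currying an infinite product
over pairs gives a product of products. It groups the offspring variables by parent. -/
lemma iIndepFun_curry {κ E : Type*} [MeasurableSpace E] {f : ι × κ → Ω → E}
    (hf : ∀ q, Measurable (f q)) (h : iIndepFun f P) :
    iIndepFun (fun i ω j => f (i, j) ω) P := by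
  have := h.isProbabilityMeasure
  have hprob : ∀ q, IsProbabilityMeasure (P.map (f q)) :=
    fun q => Measure.isProbabilityMeasure_map (hf q).aemeasurable
  have h1 : ∀ i, P.map (fun ω j => f (i, j) ω) =
      Measure.infinitePi fun j => P.map (f (i, j)) := fun i =>
    iIndepFun.map_fun_eq_infinitePi_map (X := fun j => f (i, j)) (fun j => hf _)
      (h.precomp (g := fun j => (i, j)) (fun j j' hj => by simpa using hj))
  rw [iIndepFun_iff_map_fun_eq_infinitePi_map (by fun_prop)]
  simp_rw [h1]
  rw [← Measure.infinitePi_map_curry (fun i j => P.map (f (i, j))),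
    ← h.map_fun_eq_infinitePi_map hf, Measure.map_map (by fun_prop) (by fun_prop)]
  rfl

/-- Expectation of a product of independent variables, one of which carries an extra factor. -/
lemma lintegral_prod_mul_of_iIndepFun {X S : ι → Ω → ℝ≥0∞} (hX : ∀ i, Measurable (X i))
    (hS : ∀ i, Measurable (S i)) (h : iIndepFun (fun i ω => (X i ω, S i ω)) P)
    [DecidableEq ι] (I : Finset ι) {l : ι} (hl : l ∈ I) :
    ∫⁻ ω, (∏ i ∈ I, X i ω) * S l ω ∂P =
      (∫⁻ ω, X l ω * S l ω ∂P) * ∏ i ∈ I.erase l, ∫⁻ ω, X i ω ∂P := by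
  -- The extra factor is absorbed into the `l`-th variable, leaving a plain product of independent
  -- variables.
  let φ : ι → ℝ≥0∞ × ℝ≥0∞ → ℝ≥0∞ := fun i q => if i = l then q.1 * q.2 else q.1
  have hφ : ∀ i, Measurable (φ i) := fun i => by
    by_cases hi : i = l
    · simp only [φ, hi, if_true]; fun_prop
    · simp only [φ, hi, if_false]; fun_prop
  have key := lintegral_prod_eq_prod_lintegral_of_indepFun I _ (h.comp φ hφ)
    (fun i => (hφ i).comp ((hX i).prodMk (hS i)))
  rw [← Finset.mul_prod_erase I _ hl] at key
  convert! key using 1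
  · refine lintegral_congr fun ω => ?_
    rw [← Finset.mul_prod_erase I _ hl, ← Finset.mul_prod_erase I _ hl, mul_right_comm]
    congr 1
    · simp [φ]
    · exact Finset.prod_congr rfl fun i hi => by simp [φ, Finset.ne_of_mem_erase hi]
  · congr 1
    · simp [φ]
    · exact Finset.prod_congr rfl fun i hi => by simp [φ, Finset.ne_of_mem_erase hi]

lemma lintegral_prod_of_iIndepFun {X S : ι → Ω → ℝ≥0∞} (hX : ∀ i, Measurable (X i))
    (h : iIndepFun (fun i ω => (X i ω, S i ω)) P) (I : Finset ι) :
    ∫⁻ ω, ∏ i ∈ I, X i ω ∂P = ∏ i ∈ I, ∫⁻ ω, X i ω ∂P :=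
  lintegral_prod_eq_prod_lintegral_of_indepFun I X
    (h.comp (fun _ q => q.1) fun _ => measurable_fst) hX

lemma tendsto_expNeg_sum (f : ℕ → ℝ≥0∞) :
    Tendsto (fun n => ∏ i ∈ Finset.range n, expNeg (f i)) atTop (𝓝 (expNeg (∑' i, f i))) := by
  simp_rw [← expNeg_sum]
  exact (continuous_expNeg.tendsto _).comp (ENNReal.tendsto_nat_tsum f)

/-- Finite products factorise, and dominated convergence with bound `1` passes to the limit. Writing
each expectation as `e^{-v i}` makes the infinite product an exponential of a sum. -/
lemma lintegral_expNeg_tsum {T S : ℕ → Ω → ℝ≥0∞} {v : ℕ → ℝ≥0∞}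
    (hT : ∀ i, Measurable (T i))
    (h : iIndepFun (fun i ω => (expNeg (T i ω), S i ω)) P)
    (hv : ∀ i, ∫⁻ ω, expNeg (T i ω) ∂P = expNeg (v i)) :
    ∫⁻ ω, expNeg (∑' i, T i ω) ∂P = expNeg (∑' i, v i) := by
  have := h.isProbabilityMeasure
  refine tendsto_nhds_unique (f := fun n => ∫⁻ ω, ∏ i ∈ Finset.range n, expNeg (T i ω) ∂P)
    (l := atTop) ?_ ?_
  · refine tendsto_lintegral_of_dominated_convergence (fun _ => 1)
      (fun n => Finset.measurable_prod _ fun i _ => measurable_expNeg.comp (hT i))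
      (fun n => ae_of_all _ fun ω => Finset.prod_le_one' fun i _ => expNeg_le_one _)
      (by rw [lintegral_const, measure_univ]; simp) (ae_of_all _ fun ω => tendsto_expNeg_sum _)
  · have hX : ∀ i, Measurable fun ω => expNeg (T i ω) := fun i => measurable_expNeg.comp (hT i)
    simp_rw [lintegral_prod_of_iIndepFun hX h, hv]
    exact tendsto_expNeg_sum v

/-- Expanding the sum of the `S l`, each term pairs `S l` with its own exponential and leaves the
other factors alone. The finiteness assumptions keep multiplication by `S l` and `w l` continuous.
-/
lemma lintegral_expNeg_tsum_mul_tsum {T S : ℕ → Ω → ℝ≥0∞} {v w : ℕ → ℝ≥0∞}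
    (hT : ∀ i, Measurable (T i)) (hS : ∀ i, Measurable (S i)) (hS' : ∀ i ω, S i ω ≠ ∞)
    (h : iIndepFun (fun i ω => (expNeg (T i ω), S i ω)) P)
    (hv : ∀ i, ∫⁻ ω, expNeg (T i ω) ∂P = expNeg (v i))
    (hw : ∀ i, ∫⁻ ω, expNeg (T i ω) * S i ω ∂P = expNeg (v i) * w i) (hw' : ∀ i, w i ≠ ∞) :
    ∫⁻ ω, expNeg (∑' i, T i ω) * ∑' i, S i ω ∂P = expNeg (∑' i, v i) * ∑' i, w i := by
  have := h.isProbabilityMeasure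
  have hX : ∀ i, Measurable fun ω => expNeg (T i ω) := fun i => measurable_expNeg.comp (hT i)
  simp_rw [← ENNReal.tsum_mul_left]
  have hsum : Measurable fun ω => ∑' i, T i ω := Measurable.tsum hT
  rw [lintegral_tsum fun l => (by fun_prop)]
  congr 1
  ext l
  refine tendsto_nhds_unique
    (f := fun n => ∫⁻ ω, (∏ i ∈ Finset.range n, expNeg (T i ω)) * S l ω ∂P) (l := atTop) ?_ ?_
  · rw [← tendsto_add_atTop_iff_nat (l + 1)]
    refine tendsto_lintegral_of_dominated_convergence (fun ω => expNeg (T l ω) * S l ω)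
      (fun n => (Finset.measurable_prod _ fun i _ => hX i).mul (hS l))
      (fun n => ae_of_all _ fun ω => ?_) ?_ (ae_of_all _ fun ω => ?_)
    · refine mul_le_mul_left ?_ _
      rw [← Finset.mul_prod_erase _ _ (Finset.mem_range.2 (by omega : l < n + (l + 1)))]
      exact mul_le_of_le_one_right' (Finset.prod_le_one' fun i _ => expNeg_le_one _)
    · rw [hw]
      exact ENNReal.mul_ne_top (expNeg_ne_top _) (hw' l)
    · exact ENNReal.Tendsto.mul_const ((tendsto_add_atTop_iff_nat (l + 1)).2
        (tendsto_expNeg_sum _)) (Or.inr (hS' l ω))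
  · rw [← tendsto_add_atTop_iff_nat (l + 1)]
    have : ∀ n, ∫⁻ ω, (∏ i ∈ Finset.range (n + (l + 1)), expNeg (T i ω)) * S l ω ∂P =
        (∏ i ∈ Finset.range (n + (l + 1)), expNeg (v i)) * w l := fun n => by
      have hl : l ∈ Finset.range (n + (l + 1)) := Finset.mem_range.2 (by omega)
      rw [lintegral_prod_mul_of_iIndepFun hX hS h _ hl, hw, ← Finset.mul_prod_erase _ _ hl,
        mul_right_comm]
      simp_rw [hv]
    simp_rw [this]
    exact ENNReal.Tendsto.mul_const ((tendsto_add_atTop_iff_nat (l + 1)).2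
      (tendsto_expNeg_sum _)) (Or.inr (hw' l))

end Independence

/-! ### The Poisson distribution: Mecke identity and generating function. -/

section Poisson

lemma lintegral_poissonMeasure (μ : ℝ≥0) (g : ℕ → ℝ≥0∞) :
    ∫⁻ n, g n ∂(poissonMeasure μ) =
      ∑' n : ℕ, ENNReal.ofReal (Real.exp (-μ) * μ ^ n / n.factorial) * g n := by
  rw [poissonMeasure, lintegral_sum_measure]
  simp [lintegral_smul_measure, lintegral_dirac]

/-- The Mecke equation of the Poisson distribution. -/
lemma lintegral_mul_poissonMeasure (μ : ℝ≥0) (g : ℕ → ℝ≥0∞) :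
    ∫⁻ n, n * g (n - 1) ∂(poissonMeasure μ) = μ * ∫⁻ n, g n ∂(poissonMeasure μ) := by
  -- The term `n = 0` vanishes, which makes the truncated `n - 1` harmless; the weights satisfy `(n
  -- + 1) π(n + 1) = μ π(n)`.
  rw [lintegral_poissonMeasure, lintegral_poissonMeasure, tsum_eq_zero_add' ENNReal.summable,
    ← ENNReal.tsum_mul_left]
  simp only [Nat.cast_zero, zero_mul, mul_zero, zero_add, Nat.add_sub_cancel]
  congr 1
  ext n
  rw [← mul_assoc, ← mul_assoc]
  congr 1
  rw [← ENNReal.ofReal_natCast, ← ENNReal.ofReal_coe_nnreal (p := μ),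
    ← ENNReal.ofReal_mul (by positivity), ← ENNReal.ofReal_mul (by positivity)]
  congr 1
  rw [Nat.factorial_succ]
  push_cast
  field_simp
  ring

/-- The generating function is the exponential series. The condition `a + b = 1` replaces the
truncated difference `1 - a`. -/
lemma lintegral_pow_poissonMeasure (μ : ℝ≥0) {a b : ℝ≥0∞} (hab : a + b = 1) :
    ∫⁻ n, a ^ n ∂(poissonMeasure μ) = expNeg (μ * b) := by
  have ha : a ≠ ∞ := fun h => by simp [h] at hab
  have hb : b ≠ ∞ := fun h => by simp [h] at hab
  lift a to ℝ≥0 using ha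
  lift b to ℝ≥0 using hb
  have hab' : (a : ℝ) + b = 1 := by exact_mod_cast hab
  have hs : HasSum (fun n : ℕ => Real.exp (-μ) * μ ^ n / n.factorial * (a : ℝ) ^ n)
      (Real.exp (-(μ * b))) := by
    have h := (NormedSpace.expSeries_div_hasSum_exp ((μ : ℝ) * a)).mul_left (Real.exp (-μ))
    rw [← Real.exp_eq_exp_ℝ, ← Real.exp_add] at h
    have e : -(μ : ℝ) + μ * a = -(μ * b) := by rw [eq_sub_of_add_eq hab']; ring
    rw [e] at h
    convert! h using 2 with n
    rw [mul_pow]; ring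
  rw [lintegral_poissonMeasure, ← ENNReal.coe_mul, expNeg_coe]
  push_cast
  rw [← hs.tsum_eq, ENNReal.ofReal_tsum_of_nonneg (fun n => by positivity) hs.summable]
  congr 1
  ext n
  rw [ENNReal.ofReal_mul (by positivity), ENNReal.ofReal_pow (by positivity),
    ENNReal.ofReal_coe_nnreal]

end Poisson

end

/-! ### A single thinned cluster around a fixed parent. -/

section

lemma lintegral_comp_of_indepFun {Ω E F : Type*} [MeasurableSpace Ω] [MeasurableSpace E]
    [MeasurableSpace F] {P : Measure Ω} [IsProbabilityMeasure P] {X : Ω → E} {Y : Ω → F}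
    (hX : Measurable X) (hY : Measurable Y) (h : IndepFun X Y P) {G : E → F → ℝ≥0∞}
    (hG : Measurable fun q : E × F => G q.1 q.2) :
    ∫⁻ ω, G (X ω) (Y ω) ∂P = ∫⁻ x, ∫⁻ ω, G x (Y ω) ∂P ∂(P.map X) := by
  have h1 := (indepFun_iff_map_prod_eq_prod_map_map hX.aemeasurable hY.aemeasurable).1 h
  have := Measure.isProbabilityMeasure_map (μ := P) hY.aemeasurable
  rw [← lintegral_map hG (hX.prodMk hY), h1, lintegral_prod _ hG.aemeasurable]
  refine lintegral_congr fun x => ?_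
  have hGx : Measurable fun y => G x y := hG.comp (measurable_prodMk_left (x := x))
  exact lintegral_map hGx hY

/-- The value of `f` at a point that is present only if its mark is at most the retention
probability. -/
def thin (p : Plane → ℝ≥0) (f : Plane → ℝ≥0∞) (x : Plane) (a : ℝ) : ℝ≥0∞ :=
  if a ≤ p x then f x else 0

/-- The thinned cluster of a parent at `y`, given the number of offspring and their
displacements and marks. -/
def cluster (p : Plane → ℝ≥0) (y : Plane) (e : ℕ × (ℕ → Plane × ℝ)) : Measure Plane :=
  Measure.sum fun j : ℕ =>
    if j < e.1 ∧ (e.2 j).2 ≤ p (y + (e.2 j).1) then Measure.dirac (y + (e.2 j).1) else 0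

/-- The number of offspring of parent `i`, with their displacements and marks. -/
def clusterVar {Ω : Type*} (number : ℕ → Ω → ℕ) (shift : ℕ → ℕ → Ω → Plane)
    (mark : ℕ → ℕ → Ω → ℝ) (i : ℕ) (ω : Ω) : ℕ × (ℕ → Plane × ℝ) :=
  (number i ω, fun j => (shift i j ω, mark i j ω))

/-- The thinned process with prescribed parents and cluster variables. -/
def clusterSum (p : Plane → ℝ≥0) (y : ℕ → Plane) (e : ℕ → ℕ × (ℕ → Plane × ℝ)) :
    Measure Plane :=
  Measure.sum fun i => cluster p (y i) (e i)

/-- The `p`-thinned and `k`-dispersed version of `f`. -/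
def disperse (k p : Plane → ℝ≥0) (f : Plane → ℝ≥0∞) (y : Plane) : ℝ≥0∞ :=
  ∫⁻ x, (p x : ℝ≥0∞) * k (x - y) * f x

variable {p k : Plane → ℝ≥0}

lemma measurable_thin (hp : Measurable p) {f : Plane → ℝ≥0∞} (hf : Measurable f) :
    Measurable fun q : Plane × ℝ => thin p f q.1 q.2 := by
  refine Measurable.ite (measurableSet_le measurable_snd ?_) (hf.comp measurable_fst)
    measurable_const
  exact (hp.comp measurable_fst).coe_nnreal_real

/-- Thinning commutes with `u ↦ 1 - e^{-u}` because this map fixes `0`, the value assigned to a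
deleted point. -/
lemma expNeg_thin_add (u : Plane → ℝ≥0∞) (x : Plane) (a : ℝ) :
    expNeg (thin p u x a) + thin p (fun x => 1 - expNeg (u x)) x a = 1 := by
  by_cases h : a ≤ p x
  · simp [thin, h, add_tsub_cancel_of_le (expNeg_le_one _)]
  · simp [thin, h]

lemma expNeg_thin_mul (u f : Plane → ℝ≥0∞) (x : Plane) (a : ℝ) :
    expNeg (thin p u x a) * thin p f x a = thin p (fun x => expNeg (u x) * f x) x a := by
  by_cases h : a ≤ p x <;> simp [thin, h]

lemma lintegral_cluster (y : Plane) (e : ℕ × (ℕ → Plane × ℝ)) {f : Plane → ℝ≥0∞}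
    (hf : Measurable f) :
    ∫⁻ x, f x ∂(cluster p y e) =
      ∑ j ∈ Finset.range e.1, thin p f (y + (e.2 j).1) (e.2 j).2 := by
  rw [cluster, lintegral_sum_measure, tsum_eq_sum (s := Finset.range e.1)]
  · refine Finset.sum_congr rfl fun j hj => ?_
    by_cases h : (e.2 j).2 ≤ p (y + (e.2 j).1) <;>
      simp [thin, h, Finset.mem_range.1 hj, lintegral_dirac' _ hf]
  · intro j hj
    rw [Finset.mem_range] at hj
    simp [hj]

lemma measurable_cluster (hp : Measurable p) :
    Measurable fun q : Plane × (ℕ × (ℕ → Plane × ℝ)) => cluster p q.1 q.2 := by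
  refine Measure.measurable_of_measurable_coe _ fun B hB => ?_
  simp_rw [cluster, Measure.sum_apply _ hB]
  refine Measurable.tsum fun j => ?_
  have hx : Measurable fun q : Plane × (ℕ × (ℕ → Plane × ℝ)) => q.1 + (q.2.2 j).1 := by fun_prop
  have : (fun q : Plane × (ℕ × (ℕ → Plane × ℝ)) =>
      (if j < q.2.1 ∧ (q.2.2 j).2 ≤ p (q.1 + (q.2.2 j).1) then
        Measure.dirac (q.1 + (q.2.2 j).1) else 0 : Measure Plane) B) = fun q =>
      if j < q.2.1 ∧ (q.2.2 j).2 ≤ (p (q.1 + (q.2.2 j).1) : ℝ) then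
        B.indicator (1 : Plane → ℝ≥0∞) (q.1 + (q.2.2 j).1) else 0 := by
    ext q
    split_ifs <;> simp [Measure.dirac_apply' _ hB]
  rw [this]
  refine Measurable.ite (MeasurableSet.inter ?_ ?_)
    ((measurable_one.indicator hB).comp hx) measurable_const
  · have hn : Measurable fun q : Plane × (ℕ × (ℕ → Plane × ℝ)) => q.2.1 := by fun_prop
    exact measurableSet_lt measurable_const hn
  · have ha : Measurable fun q : Plane × (ℕ × (ℕ → Plane × ℝ)) => (q.2.2 j).2 := by fun_prop
    exact measurableSet_le ha (hp.comp hx).coe_nnreal_real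

lemma measurable_measure_sum {E α ι : Type*} [MeasurableSpace E] [MeasurableSpace α] [Countable ι]
    {m : ι → E → Measure α} (hm : ∀ i, Measurable (m i)) :
    Measurable fun x => Measure.sum fun i => m i x := by
  refine Measure.measurable_of_measurable_coe _ fun B hB => ?_
  simp_rw [Measure.sum_apply _ hB]
  exact Measurable.tsum fun i => (Measure.measurable_coe hB).comp (hm i)

lemma measurable_clusterSum (hp : Measurable p) :
    Measurable fun q : (ℕ → Plane) × (ℕ → ℕ × (ℕ → Plane × ℝ)) => clusterSum p q.1 q.2 :=
  measurable_measure_sum fun i => (measurable_cluster hp).comp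
    (f := fun q : (ℕ → Plane) × (ℕ → ℕ × (ℕ → Plane × ℝ)) => (q.1 i, q.2 i)) (by fun_prop)

lemma measurable_lintegral_cluster (hp : Measurable p) {f : Plane → ℝ≥0∞} (hf : Measurable f)
    (y : Plane) : Measurable fun e => ∫⁻ x, f x ∂(cluster p y e) :=
  (Measure.measurable_lintegral hf).comp (f := fun e => cluster p y e)
    ((measurable_cluster hp).comp (f := fun e => (y, e)) (by fun_prop))

lemma thinnedProcess_eq_clusterSum {Ω : Type*} (parent : ℕ → Ω → Plane) (number : ℕ → Ω → ℕ)
    (shift : ℕ → ℕ → Ω → Plane) (mark : ℕ → ℕ → Ω → ℝ) (ω : Ω) :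
    thinnedProcess p parent number shift mark ω =
      clusterSum p (fun i => parent i ω) (fun i => clusterVar number shift mark i ω) := by
  ext B hB
  rw [thinnedProcess, clusterSum, Measure.sum_apply _ hB, Measure.sum_apply _ hB,
    ENNReal.tsum_prod']
  simp_rw [cluster, Measure.sum_apply _ hB]
  rfl

lemma measurable_disperse (hp : Measurable p) (hk : Measurable k) {f : Plane → ℝ≥0∞}
    (hf : Measurable f) : Measurable (disperse k p f) := by
  unfold disperse
  exact Measurable.lintegral_prod_right' (f := fun q : Plane × Plane =>
    (p q.2 : ℝ≥0∞) * k (q.2 - q.1) * f q.2) (by fun_prop)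

lemma disperse_le_one (hk_int : ∫⁻ z, (k z : ℝ≥0∞) = 1)
    (hp_le : ∀ x, p x ≤ 1) {f : Plane → ℝ≥0∞} (hf : ∀ x, f x ≤ 1) (y : Plane) :
    disperse k p f y ≤ 1 := by
  calc disperse k p f y ≤ ∫⁻ x, (k (x - y) : ℝ≥0∞) := by
        refine lintegral_mono fun x => ?_
        have : (p x : ℝ≥0∞) ≤ 1 := by exact_mod_cast hp_le x
        calc (p x : ℝ≥0∞) * k (x - y) * f x ≤ 1 * k (x - y) * 1 := by gcongr; exact hf x
          _ = _ := by simp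
    _ = 1 := by rw [lintegral_sub_right_eq_self (fun z => (k z : ℝ≥0∞)), hk_int]

section NeymanScott

variable {Ω : Type*} [MeasurableSpace Ω] {P : Measure Ω} {κ μ : ℝ≥0}
  {parent : ℕ → Ω → Plane} {number : ℕ → Ω → ℕ} {shift : ℕ → ℕ → Ω → Plane}
  {mark : ℕ → ℕ → Ω → ℝ}

lemma measurable_clusterVar (hNS : IsNeymanScott P κ μ k parent number shift mark) (i : ℕ) :
    Measurable (clusterVar number shift mark i) :=
  (hNS.measurable_number i).prodMk (measurable_pi_lambda _ fun j =>
    (hNS.measurable_shift i j).prodMk (hNS.measurable_mark i j))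

lemma iIndepFun_shift_mark (hNS : IsNeymanScott P κ μ k parent number shift mark) :
    iIndepFun (fun (q : ℕ × ℕ) ω => (shift q.1 q.2 ω, mark q.1 q.2 ω)) P := by
  refine iIndepFun_prodMk (fun q => hNS.measurable_shift _ _) (fun q => hNS.measurable_mark _ _)
    hNS.shift_indep hNS.mark_indep ?_
  exact hNS.shift_indep_mark.comp (φ := fun z (q : ℕ × ℕ) => z q.1 q.2)
    (ψ := fun z (q : ℕ × ℕ) => z q.1 q.2) (by fun_prop) (by fun_prop)

lemma iIndepFun_clusterVar (hNS : IsNeymanScott P κ μ k parent number shift mark) :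
    iIndepFun (fun i ω => clusterVar number shift mark i ω) P := by
  refine iIndepFun_prodMk hNS.measurable_number (fun i => measurable_pi_lambda _ fun j =>
    (hNS.measurable_shift i j).prodMk (hNS.measurable_mark i j)) hNS.number_indep
    (iIndepFun_curry (f := fun (q : ℕ × ℕ) ω => (shift q.1 q.2 ω, mark q.1 q.2 ω))
      (fun q => (hNS.measurable_shift _ _).prodMk (hNS.measurable_mark _ _))
      (iIndepFun_shift_mark hNS)) ?_
  exact hNS.number_indep_rest.comp (φ := id)
    (ψ := fun z (i j : ℕ) => (z.1 i j, z.2 i j)) measurable_id (by fun_prop)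

/-- A uniform mark is at most `p` with probability `p ≤ 1`; the displacement then contributes its
density, and translation invariance moves the variable to the location of the offspring. -/
lemma lintegral_thin [IsProbabilityMeasure P]
    (hNS : IsNeymanScott P κ μ k parent number shift mark) (hk : Measurable k)
    (hp : Measurable p) (hp_le : ∀ x, p x ≤ 1) {f : Plane → ℝ≥0∞} (hf : Measurable f)
    (i j : ℕ) (y : Plane) :
    ∫⁻ ω, thin p f (y + shift i j ω) (mark i j ω) ∂P = disperse k p f y := by
  have hind : IndepFun (shift i j) (mark i j) P :=
    hNS.shift_indep_mark.comp (φ := fun z : ℕ → ℕ → Plane => z i j)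
      (ψ := fun z : ℕ → ℕ → ℝ => z i j) (by fun_prop) (by fun_prop)
  have hm := measurable_thin hp hf
  rw [lintegral_comp_of_indepFun (hNS.measurable_shift i j) (hNS.measurable_mark i j) hind
    (G := fun z a => thin p f (y + z) a)
    (hm.comp (((measurable_const.add measurable_fst)).prodMk measurable_snd)), hNS.shift_law]
  have h1 : ∀ z, ∫⁻ ω, thin p f (y + z) (mark i j ω) ∂P = p (y + z) * f (y + z) := by
    intro z
    have hz : Measurable fun a : ℝ => thin p f (y + z) a := hm.comp measurable_prodMk_left
    rw [← lintegral_map hz (hNS.measurable_mark i j), hNS.mark_law]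
    have : (fun a : ℝ => thin p f (y + z) a) =
        (Iic (p (y + z) : ℝ)).indicator fun _ => f (y + z) := by
      ext a; simp [thin, indicator_apply]
    rw [this, lintegral_indicator_const measurableSet_Iic, Measure.restrict_apply measurableSet_Iic]
    have : Iic (p (y + z) : ℝ) ∩ Icc 0 1 = Icc 0 (p (y + z) : ℝ) := by
      ext a
      have := NNReal.coe_le_coe.2 (hp_le (y + z))
      simp only [mem_inter_iff, mem_Iic, mem_Icc, NNReal.coe_one] at *
      constructor
      · rintro ⟨h1, h2, h3⟩; exact ⟨h2, h1⟩
      · rintro ⟨h1, h2⟩; exact ⟨h2, h1, h2.trans this⟩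
    rw [this, Real.volume_Icc, sub_zero, ENNReal.ofReal_coe_nnreal, mul_comm]
  simp_rw [h1]
  rw [lintegral_withDensity_eq_lintegral_mul _ (by fun_prop) (by fun_prop), disperse,
    ← lintegral_add_left_eq_self (fun x => (p x : ℝ≥0∞) * k (x - y) * f x) y]
  refine lintegral_congr fun z => ?_
  simp only [Pi.mul_apply, add_sub_cancel_left]
  ring

lemma lintegral_expNeg_thin_add [IsProbabilityMeasure P]
    (hNS : IsNeymanScott P κ μ k parent number shift mark)
    (hk : Measurable k) (hp : Measurable p) (hp_le : ∀ x, p x ≤ 1) {u : Plane → ℝ≥0∞}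
    (hu : Measurable u) (i j : ℕ) (y : Plane) :
    ∫⁻ ω, expNeg (thin p u (y + shift i j ω) (mark i j ω)) ∂P +
      disperse k p (fun x => 1 - expNeg (u x)) y = 1 := by
  have hm : Measurable fun ω => expNeg (thin p u (y + shift i j ω) (mark i j ω)) :=
    measurable_expNeg.comp ((measurable_thin hp hu).comp
      ((measurable_const.add (hNS.measurable_shift i j)).prodMk (hNS.measurable_mark i j)))
  rw [← lintegral_thin hNS hk hp hp_le (by fun_prop) i j, ← lintegral_add_left hm]
  simp_rw [expNeg_thin_add]
  simp

/-- Both expectations complete the same finite dispersed integral to `1`, so the factor does not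
depend on the offspring index and a product over `n` offspring is an `n`-th power. -/
lemma lintegral_expNeg_thin_eq [IsProbabilityMeasure P]
    (hNS : IsNeymanScott P κ μ k parent number shift mark)
    (hk : Measurable k) (hp : Measurable p) (hp_le : ∀ x, p x ≤ 1) {u : Plane → ℝ≥0∞}
    (hu : Measurable u) (i j : ℕ) (y : Plane) :
    ∫⁻ ω, expNeg (thin p u (y + shift i j ω) (mark i j ω)) ∂P =
      ∫⁻ ω, expNeg (thin p u (y + shift i 0 ω) (mark i 0 ω)) ∂P := by
  have h1 := lintegral_expNeg_thin_add hNS hk hp hp_le hu i j y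
  have h2 := lintegral_expNeg_thin_add hNS hk hp hp_le hu i 0 y
  refine (ENNReal.add_left_inj ?_).1 (h1.trans h2.symm)
  exact fun h => by simp [h] at h1

lemma lintegral_clusterVar [IsProbabilityMeasure P]
    (hNS : IsNeymanScott P κ μ k parent number shift mark) (i : ℕ)
    {G : ℕ × (ℕ → Plane × ℝ) → ℝ≥0∞} (hG : Measurable G) :
    ∫⁻ ω, G (clusterVar number shift mark i ω) ∂P =
      ∫⁻ n, ∫⁻ ω, G (n, fun j => (shift i j ω, mark i j ω)) ∂P ∂(poissonMeasure μ) := by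
  have hind : IndepFun (number i) (fun ω (j : ℕ) => (shift i j ω, mark i j ω)) P :=
    hNS.number_indep_rest.comp (φ := fun z : ℕ → ℕ => z i)
      (ψ := fun z : (ℕ → ℕ → Plane) × (ℕ → ℕ → ℝ) => fun j : ℕ => (z.1 i j, z.2 i j))
      (measurable_pi_apply i) (by fun_prop)
  rw [← hNS.number_law i]
  exact lintegral_comp_of_indepFun (hNS.measurable_number i) (measurable_pi_lambda _ fun j =>
    (hNS.measurable_shift i j).prodMk (hNS.measurable_mark i j)) hind
    (G := fun n z => G (n, z)) hG

lemma iIndepFun_thin (hNS : IsNeymanScott P κ μ k parent number shift mark)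
    (hp : Measurable p) {u f : Plane → ℝ≥0∞} (hu : Measurable u) (hf : Measurable f)
    (i : ℕ) (y : Plane) :
    iIndepFun (fun j ω => (expNeg (thin p u (y + shift i j ω) (mark i j ω)),
      thin p f (y + shift i j ω) (mark i j ω))) P := by
  have h := (iIndepFun_shift_mark hNS).precomp (g := fun j => (i, j))
    (fun j j' hj => by simpa using hj)
  have hq : Measurable fun q : Plane × ℝ => (y + q.1, q.2) := by fun_prop
  exact h.comp (fun _ q => (expNeg (thin p u (y + q.1) q.2), thin p f (y + q.1) q.2))
    fun _ => (measurable_expNeg.comp ((measurable_thin hp hu).comp hq)).prodMk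
      ((measurable_thin hp hf).comp hq)

lemma measurable_thin_shift (hNS : IsNeymanScott P κ μ k parent number shift mark)
    (hp : Measurable p) {f : Plane → ℝ≥0∞} (hf : Measurable f) (y : Plane) (i j : ℕ) :
    Measurable fun ω => thin p f (y + shift i j ω) (mark i j ω) :=
  (measurable_thin hp hf).comp
    ((measurable_const.add (hNS.measurable_shift i j)).prodMk (hNS.measurable_mark i j))

/-- The Laplace functional of a single thinned cluster. -/
lemma lintegral_expNeg_cluster [IsProbabilityMeasure P]
    (hNS : IsNeymanScott P κ μ k parent number shift mark)
    (hk : Measurable k) (hp : Measurable p) (hp_le : ∀ x, p x ≤ 1) {u : Plane → ℝ≥0∞}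
    (hu : Measurable u) (i : ℕ) (y : Plane) :
    ∫⁻ ω, expNeg (∫⁻ x, u x ∂(cluster p y (clusterVar number shift mark i ω))) ∂P =
      expNeg (μ * disperse k p (fun x => 1 - expNeg (u x)) y) := by
  rw [lintegral_clusterVar hNS i (G := fun e => expNeg (∫⁻ x, u x ∂(cluster p y e)))
    (measurable_expNeg.comp (measurable_lintegral_cluster hp hu y)),
    ← lintegral_pow_poissonMeasure μ (lintegral_expNeg_thin_add hNS hk hp hp_le hu i 0 y)]
  -- With `n` offspring the expectation is the `n`-th power of the one-point factor; the Poisson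
  -- generating function has already been applied on the right.
  refine lintegral_congr fun n => ?_
  simp_rw [lintegral_cluster y _ hu, expNeg_sum]
  have hE : ∀ j, Measurable fun ω => expNeg (thin p u (y + shift i j ω) (mark i j ω)) :=
    fun j => measurable_expNeg.comp (measurable_thin_shift hNS hp hu y i j)
  rw [lintegral_prod_of_iIndepFun hE (iIndepFun_thin hNS hp hu hu i y)]
  simp_rw [lintegral_expNeg_thin_eq hNS hk hp hp_le hu i _ y]
  simp

/-- With `n` offspring there are `n` choices of the point that carries `f`; each gives one dispersed
integral of `e^{-u} f` and `n - 1` one-point factors. The Mecke identity of the Poisson distribution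
turns the weight `n a^(n-1)` into `μ a^n`. -/
lemma lintegral_expNeg_cluster_mul [IsProbabilityMeasure P]
    (hNS : IsNeymanScott P κ μ k parent number shift mark)
    (hk : Measurable k) (hp : Measurable p) (hp_le : ∀ x, p x ≤ 1) {u f : Plane → ℝ≥0∞}
    (hu : Measurable u) (hf : Measurable f) (i : ℕ) (y : Plane) :
    ∫⁻ ω, expNeg (∫⁻ x, u x ∂(cluster p y (clusterVar number shift mark i ω))) *
        ∫⁻ x, f x ∂(cluster p y (clusterVar number shift mark i ω)) ∂P =
      expNeg (μ * disperse k p (fun x => 1 - expNeg (u x)) y) *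
        (μ * disperse k p (fun x => expNeg (u x) * f x) y) := by
  rw [lintegral_clusterVar hNS i (G := fun e => expNeg (∫⁻ x, u x ∂(cluster p y e)) *
    ∫⁻ x, f x ∂(cluster p y e)) ((measurable_expNeg.comp
    (measurable_lintegral_cluster hp hu y)).mul (measurable_lintegral_cluster hp hf y)),
    ← lintegral_pow_poissonMeasure μ (lintegral_expNeg_thin_add hNS hk hp hp_le hu i 0 y),
    ← mul_assoc, mul_comm _ (μ : ℝ≥0∞), ← lintegral_mul_poissonMeasure,
    ← lintegral_mul_const _ (measurable_of_countable _)]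
  refine lintegral_congr fun n => ?_
  have hT := measurable_thin_shift hNS hp hu y i
  have hS := measurable_thin_shift hNS hp hf y i
  have hE : ∀ j, Measurable fun ω => expNeg (thin p u (y + shift i j ω) (mark i j ω)) :=
    fun j => measurable_expNeg.comp (hT j)
  simp_rw [lintegral_cluster y _ hu, lintegral_cluster y _ hf, expNeg_sum, Finset.mul_sum]
  rw [lintegral_finsetSum _ fun l _ => by fun_prop]
  rw [Finset.sum_congr rfl fun l hl => lintegral_prod_mul_of_iIndepFun hE hS
    (iIndepFun_thin hNS hp hu hf i y) _ hl]
  simp only [lintegral_expNeg_thin_eq hNS hk hp hp_le hu i _ y, expNeg_thin_mul, Finset.prod_const]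
  rw [Finset.sum_congr rfl (g := fun l => disperse k p (fun x => expNeg (u x) * f x) y *
    (∫⁻ ω, expNeg (thin p u (y + shift i 0 ω) (mark i 0 ω)) ∂P) ^ (n - 1)) fun l hl => by
      rw [lintegral_thin hNS hk hp hp_le (by fun_prop), Finset.card_erase_of_mem hl,
        Finset.card_range]]
  simp only [Finset.sum_const, Finset.card_range, nsmul_eq_mul]
  ring

end NeymanScott

end

/-! ### The thinned process, with the clusters integrated out. -/

section

lemma lintegral_parentProcess {Ω : Type*} (parent : ℕ → Ω → Plane) (ω : Ω) {f : Plane → ℝ≥0∞}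
    (hf : Measurable f) : ∫⁻ x, f x ∂(parentProcess parent ω) = ∑' i, f (parent i ω) := by
  rw [parentProcess, lintegral_sum_measure]
  simp_rw [lintegral_dirac' _ hf]

section NeymanScott

variable {p k : Plane → ℝ≥0} {Ω : Type*} [MeasurableSpace Ω] {P : Measure Ω} {κ μ : ℝ≥0}
  {parent : ℕ → Ω → Plane} {number : ℕ → Ω → ℕ} {shift : ℕ → ℕ → Ω → Plane}
  {mark : ℕ → ℕ → Ω → ℝ}

lemma iIndepFun_lintegral_cluster (hNS : IsNeymanScott P κ μ k parent number shift mark)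
    (hp : Measurable p) {u f : Plane → ℝ≥0∞} (hu : Measurable u) (hf : Measurable f)
    (y : ℕ → Plane) :
    iIndepFun (fun i ω =>
      (expNeg (∫⁻ x, u x ∂(cluster p (y i) (clusterVar number shift mark i ω))),
        ∫⁻ x, f x ∂(cluster p (y i) (clusterVar number shift mark i ω)))) P :=
  (iIndepFun_clusterVar hNS).comp (fun i e => (expNeg (∫⁻ x, u x ∂(cluster p (y i) e)),
    ∫⁻ x, f x ∂(cluster p (y i) e))) fun i =>
    (measurable_expNeg.comp (measurable_lintegral_cluster hp hu (y i))).prodMk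
      (measurable_lintegral_cluster hp hf (y i))

lemma measurable_lintegral_clusterVar (hNS : IsNeymanScott P κ μ k parent number shift mark)
    (hp : Measurable p) {f : Plane → ℝ≥0∞} (hf : Measurable f) (y : Plane) (i : ℕ) :
    Measurable fun ω => ∫⁻ x, f x ∂(cluster p y (clusterVar number shift mark i ω)) :=
  (measurable_lintegral_cluster hp hf y).comp (measurable_clusterVar hNS i)

lemma lintegral_expNeg_clusterSum [IsProbabilityMeasure P]
    (hNS : IsNeymanScott P κ μ k parent number shift mark)
    (hk : Measurable k) (hp : Measurable p) (hp_le : ∀ x, p x ≤ 1) {u : Plane → ℝ≥0∞}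
    (hu : Measurable u) (y : ℕ → Plane) :
    ∫⁻ ω, expNeg (∫⁻ x, u x ∂(clusterSum p y fun i => clusterVar number shift mark i ω)) ∂P =
      expNeg (∑' i, μ * disperse k p (fun x => 1 - expNeg (u x)) (y i)) := by
  simp_rw [clusterSum, lintegral_sum_measure]
  exact lintegral_expNeg_tsum (fun i => measurable_lintegral_clusterVar hNS hp hu (y i) i)
    (iIndepFun_lintegral_cluster hNS hp hu hu y)
    fun i => lintegral_expNeg_cluster hNS hk hp hp_le hu i (y i)

/-- With the parents fixed the clusters are independent, so the one-cluster formulas combine. The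
bound `f ≤ 1` makes each cluster integral and each dispersed integral finite. -/
lemma lintegral_expNeg_clusterSum_mul [IsProbabilityMeasure P]
    (hNS : IsNeymanScott P κ μ k parent number shift mark)
    (hk : Measurable k) (hk_int : ∫⁻ z, (k z : ℝ≥0∞) = 1) (hp : Measurable p)
    (hp_le : ∀ x, p x ≤ 1) {u f : Plane → ℝ≥0∞}
    (hu : Measurable u) (hf : Measurable f) (hf1 : ∀ x, f x ≤ 1) (y : ℕ → Plane) :
    ∫⁻ ω, expNeg (∫⁻ x, u x ∂(clusterSum p y fun i => clusterVar number shift mark i ω)) *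
        ∫⁻ x, f x ∂(clusterSum p y fun i => clusterVar number shift mark i ω) ∂P =
      expNeg (∑' i, μ * disperse k p (fun x => 1 - expNeg (u x)) (y i)) *
        ∑' i, μ * disperse k p (fun x => expNeg (u x) * f x) (y i) := by
  simp_rw [clusterSum, lintegral_sum_measure]
  refine lintegral_expNeg_tsum_mul_tsum
    (fun i => measurable_lintegral_clusterVar hNS hp hu (y i) i)
    (fun i => measurable_lintegral_clusterVar hNS hp hf (y i) i) (fun i ω => ?_)
    (iIndepFun_lintegral_cluster hNS hp hu hf y)
    (fun i => lintegral_expNeg_cluster hNS hk hp hp_le hu i (y i))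
    (fun i => lintegral_expNeg_cluster_mul hNS hk hp hp_le hu hf i (y i)) fun i => ?_
  · rw [lintegral_cluster _ _ hf]
    refine ENNReal.sum_ne_top.2 fun j _ => ne_top_of_le_ne_top ENNReal.one_ne_top ?_
    unfold thin
    split_ifs
    · exact hf1 _
    · exact zero_le_one
  · refine ENNReal.mul_ne_top ENNReal.coe_ne_top (ne_top_of_le_ne_top ENNReal.one_ne_top
      (disperse_le_one hk_int hp_le (fun x => ?_) _))
    exact mul_le_one' (expNeg_le_one _) (hf1 x)

lemma indepFun_parent_clusterVar (hNS : IsNeymanScott P κ μ k parent number shift mark) :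
    IndepFun (fun ω i => parent i ω) (fun ω i => clusterVar number shift mark i ω) P :=
  hNS.parent_indep.comp (φ := id)
    (ψ := fun z : (ℕ → ℕ) × (ℕ → ℕ → Plane) × (ℕ → ℕ → ℝ) =>
      fun i : ℕ => (z.1 i, fun j : ℕ => (z.2.1 i j, z.2.2 i j))) measurable_id (by fun_prop)

/-- Integration over the clusters with the parents held fixed. -/
lemma lintegral_parent_clusterVar [IsProbabilityMeasure P]
    (hNS : IsNeymanScott P κ μ k parent number shift mark)
    {G : (ℕ → Plane) → (ℕ → ℕ × (ℕ → Plane × ℝ)) → ℝ≥0∞}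
    (hG : Measurable fun q : (ℕ → Plane) × (ℕ → ℕ × (ℕ → Plane × ℝ)) => G q.1 q.2)
    {H : (ℕ → Plane) → ℝ≥0∞} (hH : Measurable H)
    (h : ∀ y, ∫⁻ ω, G y (fun i => clusterVar number shift mark i ω) ∂P = H y) :
    ∫⁻ ω, G (fun i => parent i ω) (fun i => clusterVar number shift mark i ω) ∂P =
      ∫⁻ ω, H (fun i => parent i ω) ∂P := by
  have hpar : Measurable fun ω i => parent i ω := measurable_pi_lambda _ hNS.measurable_parent
  rw [lintegral_comp_of_indepFun hpar (measurable_pi_lambda _ (measurable_clusterVar hNS))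
    (indepFun_parent_clusterVar hNS) hG]
  simp_rw [h]
  rw [lintegral_map hH hpar]

lemma measurable_lintegral_clusterSum (hp : Measurable p) {f : Plane → ℝ≥0∞} (hf : Measurable f) :
    Measurable fun q : (ℕ → Plane) × (ℕ → ℕ × (ℕ → Plane × ℝ)) =>
      ∫⁻ x, f x ∂(clusterSum p q.1 q.2) :=
  (Measure.measurable_lintegral hf).comp
    (f := fun q : (ℕ → Plane) × (ℕ → ℕ × (ℕ → Plane × ℝ)) => clusterSum p q.1 q.2)
    (measurable_clusterSum hp)

/-- The Laplace functional of the thinned process, jointly with a function of the parents. -/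
lemma lintegral_expNeg_thinnedProcess [IsProbabilityMeasure P]
    (hNS : IsNeymanScott P κ μ k parent number shift mark)
    (hk : Measurable k) (hp : Measurable p) (hp_le : ∀ x, p x ≤ 1) {u g : Plane → ℝ≥0∞}
    (hu : Measurable u) (hg : Measurable g) (c : ℝ≥0∞) :
    ∫⁻ ω, expNeg (∫⁻ x, u x ∂(thinnedProcess p parent number shift mark ω)) *
        (∫⁻ x, g x ∂(parentProcess parent ω) + c) ∂P =
      ∫⁻ ω, expNeg (∫⁻ y, μ * disperse k p (fun x => 1 - expNeg (u x)) y
        ∂(parentProcess parent ω)) * (∫⁻ x, g x ∂(parentProcess parent ω) + c) ∂P := by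
  have hd : Measurable fun y => μ * disperse k p (fun x => 1 - expNeg (u x)) y :=
    (measurable_disperse hp hk (by fun_prop)).const_mul _
  simp_rw [lintegral_parentProcess _ _ hg, lintegral_parentProcess _ _ hd,
    thinnedProcess_eq_clusterSum]
  have hS : Measurable fun y : ℕ → Plane => ∑' i, g (y i) :=
    Measurable.tsum fun i => hg.comp (measurable_pi_apply i)
  have hV : Measurable fun y : ℕ → Plane =>
      ∑' i, μ * disperse k p (fun x => 1 - expNeg (u x)) (y i) :=
    Measurable.tsum fun i => hd.comp (measurable_pi_apply i)
  have hC := measurable_lintegral_clusterSum hp hu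
  have hG : Measurable fun q : (ℕ → Plane) × (ℕ → ℕ × (ℕ → Plane × ℝ)) =>
      expNeg (∫⁻ x, u x ∂(clusterSum p q.1 q.2)) * (∑' i, g (q.1 i) + c) :=
    (measurable_expNeg.comp hC).mul ((hS.comp measurable_fst).add_const c)
  have hH : Measurable fun y : ℕ → Plane => expNeg (∑' i,
      μ * disperse k p (fun x => 1 - expNeg (u x)) (y i)) * (∑' i, g (y i) + c) :=
    (measurable_expNeg.comp hV).mul (hS.add_const c)
  refine lintegral_parent_clusterVar hNS
    (G := fun y e => expNeg (∫⁻ x, u x ∂(clusterSum p y e)) * (∑' i, g (y i) + c))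
    (H := fun y => expNeg (∑' i, μ * disperse k p (fun x => 1 - expNeg (u x)) (y i)) *
      (∑' i, g (y i) + c)) hG hH fun y => ?_
  rw [lintegral_mul_const, lintegral_expNeg_clusterSum hNS hk hp hp_le hu]
  exact measurable_expNeg.comp (hC.comp (f := fun ω => (y, fun i => clusterVar number shift mark i ω))
    (measurable_const.prodMk (measurable_pi_lambda _ (measurable_clusterVar hNS))))

/-- The Laplace functional of the thinned process, jointly with an integral against it. -/
lemma lintegral_expNeg_mul_thinnedProcess [IsProbabilityMeasure P]
    (hNS : IsNeymanScott P κ μ k parent number shift mark)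
    (hk : Measurable k) (hk_int : ∫⁻ z, (k z : ℝ≥0∞) = 1) (hp : Measurable p)
    (hp_le : ∀ x, p x ≤ 1) {u f : Plane → ℝ≥0∞}
    (hu : Measurable u) (hf : Measurable f) (hf1 : ∀ x, f x ≤ 1) :
    ∫⁻ ω, expNeg (∫⁻ x, u x ∂(thinnedProcess p parent number shift mark ω)) *
        ∫⁻ x, f x ∂(thinnedProcess p parent number shift mark ω) ∂P =
      ∫⁻ ω, expNeg (∫⁻ y, μ * disperse k p (fun x => 1 - expNeg (u x)) y
        ∂(parentProcess parent ω)) *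
        ∫⁻ y, μ * disperse k p (fun x => expNeg (u x) * f x) y ∂(parentProcess parent ω) ∂P := by
  have hd : Measurable fun y => μ * disperse k p (fun x => 1 - expNeg (u x)) y :=
    (measurable_disperse hp hk (by fun_prop)).const_mul _
  have hd' : Measurable fun y => μ * disperse k p (fun x => expNeg (u x) * f x) y :=
    (measurable_disperse hp hk (by fun_prop)).const_mul _
  simp_rw [lintegral_parentProcess _ _ hd, lintegral_parentProcess _ _ hd',
    thinnedProcess_eq_clusterSum]
  have hV : Measurable fun y : ℕ → Plane =>
      ∑' i, μ * disperse k p (fun x => 1 - expNeg (u x)) (y i) :=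
    Measurable.tsum fun i => hd.comp (measurable_pi_apply i)
  have hV' : Measurable fun y : ℕ → Plane =>
      ∑' i, μ * disperse k p (fun x => expNeg (u x) * f x) (y i) :=
    Measurable.tsum fun i => hd'.comp (measurable_pi_apply i)
  have hC := measurable_lintegral_clusterSum hp hu
  have hC' := measurable_lintegral_clusterSum hp hf
  have hG : Measurable fun q : (ℕ → Plane) × (ℕ → ℕ × (ℕ → Plane × ℝ)) =>
      expNeg (∫⁻ x, u x ∂(clusterSum p q.1 q.2)) * ∫⁻ x, f x ∂(clusterSum p q.1 q.2) :=
    (measurable_expNeg.comp hC).mul hC'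
  have hH : Measurable fun y : ℕ → Plane => expNeg (∑' i,
      μ * disperse k p (fun x => 1 - expNeg (u x)) (y i)) *
      ∑' i, μ * disperse k p (fun x => expNeg (u x) * f x) (y i) :=
    (measurable_expNeg.comp hV).mul hV'
  exact lintegral_parent_clusterVar hNS
    (G := fun y e => expNeg (∫⁻ x, u x ∂(clusterSum p y e)) * ∫⁻ x, f x ∂(clusterSum p y e))
    (H := fun y => expNeg (∑' i, μ * disperse k p (fun x => 1 - expNeg (u x)) (y i)) *
      ∑' i, μ * disperse k p (fun x => expNeg (u x) * f x) (y i)) hG hH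
    (lintegral_expNeg_clusterSum_mul hNS hk hk_int hp hp_le hu hf hf1)

end NeymanScott

end

/-! ### The Mecke equation of a Poisson process. -/

section

section Poisson

variable {Ω : Type*} [MeasurableSpace Ω] {P : Measure Ω} {Λ : Measure Plane}
  {η : Ω → Measure Plane}

lemma measurable_lintegral_comp {α : Type*} [MeasurableSpace α] {η : Ω → Measure α}
    (hη : Measurable η) {f : α → ℝ≥0∞} (hf : Measurable f) :
    Measurable fun ω => ∫⁻ x, f x ∂(η ω) :=
  (Measure.measurable_lintegral hf).comp hη

lemma measurable_apply_comp {α : Type*} [MeasurableSpace α] {η : Ω → Measure α}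
    (hη : Measurable η) {B : Set α} (hB : MeasurableSet B) : Measurable fun ω => η ω B :=
  (Measure.measurable_coe hB).comp hη

lemma IsPoissonProcess.lintegral_comp_count (h : IsPoissonProcess P Λ η) {B : Set Plane}
    (hB : MeasurableSet B) (hΛB : Λ B ≠ ∞) {g : ℝ≥0∞ → ℝ≥0∞} (hg : Measurable g) :
    ∫⁻ ω, g (η ω B) ∂P = ∫⁻ n : ℕ, g n ∂(poissonMeasure (Λ B).toNNReal) := by
  rw [← lintegral_map hg (measurable_apply_comp h.measurable hB), h.count_law B hB hΛB,
    lintegral_map hg (measurable_of_countable _)]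

lemma IsPoissonProcess.iIndepFun_count (h : IsPoissonProcess P Λ η) {ι : Type*} [Finite ι]
    {B : ι → Set Plane} (hB : ∀ i, MeasurableSet (B i))
    (hd : Pairwise fun i j => Disjoint (B i) (B j)) : iIndepFun (fun i ω => η ω (B i)) P := by
  obtain ⟨n, ⟨e⟩⟩ := Finite.exists_equiv_fin ι
  have h1 := h.count_indep n (fun i => B (e.symm i)) (fun i => hB _)
    fun i j hij => hd (e.symm.injective.ne hij)
  simpa using h1.precomp e.injective

lemma IsPoissonProcess.lintegral_expNeg_mul_count (h : IsPoissonProcess P Λ η) {B : Set Plane}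
    (hB : MeasurableSet B) (hΛB : Λ B ≠ ∞) (s : ℝ≥0∞) :
    ∫⁻ ω, expNeg (s * η ω B) * η ω B ∂P = Λ B * expNeg s * ∫⁻ ω, expNeg (s * η ω B) ∂P := by
  rw [h.lintegral_comp_count hB hΛB (g := fun x => expNeg (s * x) * x) (by fun_prop),
    h.lintegral_comp_count hB hΛB (g := fun x => expNeg (s * x)) (by fun_prop)]
  have := lintegral_mul_poissonMeasure (Λ B).toNNReal fun n => expNeg s * expNeg (s * n)
  rw [lintegral_const_mul _ (measurable_of_countable _), ENNReal.coe_toNNReal hΛB] at this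
  rw [mul_assoc, ← this]
  refine lintegral_congr fun n => ?_
  cases n with
  | zero => simp
  | succ n => rw [← expNeg_add, mul_comm]; push_cast; simp [mul_add, add_comm]

/-- On `B` the function is constant, so `∫ v dη` is `s η(B)` plus counts on disjoint sets outside
`B`. Independence reduces the claim to the Poisson variable `η(B)`. -/
lemma IsPoissonProcess.lintegral_expNeg_simpleFunc_mul_of_subset (h : IsPoissonProcess P Λ η)
    (v : SimpleFunc Plane ℝ≥0∞) {s : ℝ≥0∞} {B : Set Plane}
    (hB : MeasurableSet B) (hΛB : Λ B ≠ ∞) (hs : B ⊆ v ⁻¹' {s}) :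
    ∫⁻ ω, expNeg (∫⁻ x, v x ∂(η ω)) * η ω B ∂P =
      (∫⁻ ω, expNeg (∫⁻ x, v x ∂(η ω)) ∂P) * (expNeg s * Λ B) := by
  classical
  -- The cells are `B` itself, indexed by `none`, and the level sets of `v` with `B` removed. The
  -- latter may have infinite intensity; only independence of their counts is used.
  let C : Option v.range → Set Plane := fun o => o.elim B fun r => v ⁻¹' {r.1} ∩ Bᶜ
  have hC : ∀ o, MeasurableSet (C o) := by
    rintro (_ | r)
    · exact hB
    · exact (v.measurableSet_preimage _).inter hB.compl
  have hCd : Pairwise fun i j => Disjoint (C i) (C j) := by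
    rintro (_ | r) (_ | r') hrr
    · exact absurd rfl hrr
    · exact disjoint_compl_right.mono_right inter_subset_right
    · exact disjoint_compl_left.mono_left inter_subset_right
    · refine Disjoint.mono inter_subset_left inter_subset_left (Disjoint.preimage _ ?_)
      rw [disjoint_singleton]
      exact fun h => hrr (by rw [Subtype.ext h])
  have hmeas : ∀ o, Measurable fun ω => η ω (C o) := fun o =>
    measurable_apply_comp h.measurable (hC o)
  have hind := (h.iIndepFun_count hC hCd).indepFun_finset {none} {none}ᶜ disjoint_compl_right hmeas
  let rest : Ω → ℝ≥0∞ := fun ω => ∑ r : v.range, r.1 * η ω (C (some r))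
  have hrest : Measurable rest := Finset.measurable_sum _ fun r _ => (hmeas _).const_mul _
  have hsum : ∀ ω, ∫⁻ x, v x ∂(η ω) = s * η ω B + rest ω := by
    intro ω
    rw [← lintegral_add_compl _ hB]
    congr 1
    · rw [setLIntegral_congr_fun hB (g := fun _ => s) fun x hx => hs hx, setLIntegral_const]
    · rw [SimpleFunc.lintegral_eq_lintegral, SimpleFunc.lintegral, ← Finset.sum_coe_sort]
      refine Finset.sum_congr rfl fun r _ => ?_
      rw [Measure.restrict_apply (v.measurableSet_preimage _)]
      rfl
  have hind' : IndepFun (fun ω => η ω B) rest P := by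
    refine hind.comp (φ := fun x : ({none} : Finset (Option v.range)) → ℝ≥0∞ => x ⟨none, by simp⟩)
      (ψ := fun x : ({none}ᶜ : Finset (Option v.range)) → ℝ≥0∞ =>
        ∑ r : v.range, r.1 * x ⟨some r, by simp⟩) (by fun_prop) ?_
    exact Finset.measurable_sum _ fun r _ => (measurable_pi_apply _).const_mul _
  have hBm := measurable_apply_comp h.measurable hB
  have e1 : ∫⁻ ω, (expNeg (s * η ω B) * η ω B) * expNeg (rest ω) ∂P = _ :=
    lintegral_mul_eq_lintegral_mul_lintegral_of_indepFun'' (by fun_prop) (by fun_prop)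
      (hind'.comp (φ := fun x => expNeg (s * x) * x) (ψ := expNeg) (by fun_prop) (by fun_prop))
  have e2 : ∫⁻ ω, expNeg (s * η ω B) * expNeg (rest ω) ∂P = _ :=
    lintegral_mul_eq_lintegral_mul_lintegral_of_indepFun'' (by fun_prop) (by fun_prop)
      (hind'.comp (φ := fun x => expNeg (s * x)) (ψ := expNeg) (by fun_prop) (by fun_prop))
  simp_rw [hsum, expNeg_add, mul_right_comm _ (expNeg (rest _))]
  rw [e1, e2, h.lintegral_expNeg_mul_count hB hΛB]
  ring

/-- The measure `B ↦ E[X η(B)]` is this `bind`; having it as a measure lets identities for sets pass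
to all measurable functions. -/
lemma lintegral_bind_withDensity (hη : Measurable η) {X : Ω → ℝ≥0∞} (hX : Measurable X)
    {f : Plane → ℝ≥0∞} (hf : Measurable f) :
    ∫⁻ x, f x ∂((P.withDensity X).bind η) = ∫⁻ ω, X ω * ∫⁻ x, f x ∂(η ω) ∂P := by
  rw [Measure.lintegral_bind hη.aemeasurable hf.aemeasurable,
    lintegral_withDensity_eq_lintegral_mul _ hX (measurable_lintegral_comp hη hf)]
  rfl

lemma bind_withDensity_apply (hη : Measurable η) {X : Ω → ℝ≥0∞} (hX : Measurable X)
    {B : Set Plane} (hB : MeasurableSet B) :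
    (P.withDensity X).bind η B = ∫⁻ ω, X ω * η ω B ∂P := by
  rw [← lintegral_indicator_one hB,
    lintegral_bind_withDensity hη hX (measurable_one.indicator hB)]
  simp_rw [lintegral_indicator_one hB]

/-- Measures that agree on all measurable sets of finite measure are equal. -/
lemma ext_of_finite_sets [SigmaFinite Λ] {m₁ m₂ : Measure Plane}
    (h : ∀ B, MeasurableSet B → Λ B ≠ ∞ → m₁ B = m₂ B) : m₁ = m₂ := by
  refine Measure.ext_of_iUnion_eq_univ (iUnion_spanningSets Λ) fun n => ?_
  ext B hB
  rw [Measure.restrict_apply hB, Measure.restrict_apply hB]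
  exact h _ (hB.inter (measurableSet_spanningSets Λ n))
    ((measure_mono inter_subset_right).trans_lt (measure_spanningSets_lt_top Λ n)).ne

lemma IsPoissonProcess.lintegral_expNeg_simpleFunc_mul [SigmaFinite Λ]
    (h : IsPoissonProcess P Λ η) (v : SimpleFunc Plane ℝ≥0∞) {B : Set Plane}
    (hB : MeasurableSet B) :
    ∫⁻ ω, expNeg (∫⁻ x, v x ∂(η ω)) * η ω B ∂P =
      (∫⁻ ω, expNeg (∫⁻ x, v x ∂(η ω)) ∂P) * ∫⁻ x in B, expNeg (v x) ∂Λ := by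
  have hX : Measurable fun ω => expNeg (∫⁻ x, v x ∂(η ω)) :=
    measurable_expNeg.comp (measurable_lintegral_comp h.measurable v.measurable)
  rw [← bind_withDensity_apply h.measurable hX hB, ← withDensity_apply _ hB, ← smul_eq_mul,
    ← Measure.smul_apply]
  congr 1
  refine ext_of_finite_sets (Λ := Λ) fun B hB hΛB => ?_
  have key : ((P.withDensity fun ω => expNeg (∫⁻ x, v x ∂(η ω))).bind η).restrict B =
      ((∫⁻ ω, expNeg (∫⁻ x, v x ∂(η ω)) ∂P) •
        Λ.withDensity fun x => expNeg (v x)).restrict B := by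
    -- The finitely many level sets of `v` cover the plane, and inside each of them `v` is constant.
    refine Measure.ext_of_biUnion_eq_univ (s := fun r => v ⁻¹' {r}) v.range.countable_toSet
      (by ext x; simp) fun r hr => ?_
    ext C hC
    rw [Measure.restrict_apply hC, Measure.restrict_apply hC,
      Measure.restrict_apply (hC.inter (v.measurableSet_preimage _)),
      Measure.restrict_apply (hC.inter (v.measurableSet_preimage _))]
    have hD : MeasurableSet (C ∩ v ⁻¹' {r} ∩ B) :=
      (hC.inter (v.measurableSet_preimage _)).inter hB
    have hDr : C ∩ v ⁻¹' {r} ∩ B ⊆ v ⁻¹' {r} := fun x hx => hx.1.2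
    rw [bind_withDensity_apply h.measurable hX hD, Measure.smul_apply, withDensity_apply _ hD,
      h.lintegral_expNeg_simpleFunc_mul_of_subset v hD
        ((measure_mono inter_subset_right).trans_lt (lt_top_iff_ne_top.2 hΛB)).ne hDr,
      setLIntegral_congr_fun hD (g := fun _ => expNeg r)
        fun x hx => by rw [show v x = r from hDr hx],
      setLIntegral_const, smul_eq_mul]
  have := congrArg (fun m : Measure Plane => m univ) key
  simpa using this

lemma IsPoissonProcess.lintegral_count (h : IsPoissonProcess P Λ η) [IsProbabilityMeasure P]
    [SigmaFinite Λ] {B : Set Plane}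
    (hB : MeasurableSet B) : ∫⁻ ω, η ω B ∂P = Λ B := by
  have := h.lintegral_expNeg_simpleFunc_mul 0 hB
  simpa using this

lemma IsPoissonProcess.lintegral_expNeg_mul_apply [IsProbabilityMeasure P] [SigmaFinite Λ]
    (h : IsPoissonProcess P Λ η) {v : Plane → ℝ≥0∞} (hv : Measurable v) {B : Set Plane}
    (hB : MeasurableSet B) (hΛB : Λ B ≠ ∞) :
    ∫⁻ ω, expNeg (∫⁻ x, v x ∂(η ω)) * η ω B ∂P =
      (∫⁻ ω, expNeg (∫⁻ x, v x ∂(η ω)) ∂P) * ∫⁻ x in B, expNeg (v x) ∂Λ := by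
  have hBm := measurable_apply_comp h.measurable hB
  have hvn : ∀ n, Measurable fun ω => expNeg (∫⁻ x, SimpleFunc.eapprox v n x ∂(η ω)) := fun n =>
    measurable_expNeg.comp (measurable_lintegral_comp h.measurable (SimpleFunc.measurable _))
  have hlim : ∀ ω, Tendsto (fun n => expNeg (∫⁻ x, SimpleFunc.eapprox v n x ∂(η ω))) atTop
      (𝓝 (expNeg (∫⁻ x, v x ∂(η ω)))) := by
    intro ω
    refine (continuous_expNeg.tendsto _).comp ?_
    refine lintegral_tendsto_of_tendsto_of_monotone
      (fun n => (SimpleFunc.measurable _).aemeasurable)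
      (ae_of_all _ fun x => fun i j hij => SimpleFunc.monotone_eapprox v hij x)
      (ae_of_all _ fun x => SimpleFunc.tendsto_eapprox hv x)
  have hfin : ∫⁻ ω, η ω B ∂P ≠ ∞ := by rwa [h.lintegral_count hB]
  refine tendsto_nhds_unique (f := fun n =>
    ∫⁻ ω, expNeg (∫⁻ x, SimpleFunc.eapprox v n x ∂(η ω)) * η ω B ∂P) (l := atTop) ?_ ?_
  -- The count `η(B)` dominates and is integrable because `Λ B` is finite; simple functions
  -- increasing to `v` then suffice.
  · refine tendsto_lintegral_of_dominated_convergence (fun ω => η ω B)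
      (fun n => (hvn n).mul hBm) (fun n => ae_of_all _ fun ω =>
        mul_le_of_le_one_left' (expNeg_le_one _)) hfin ?_
    filter_upwards [ae_lt_top hBm hfin] with ω hω
    exact ENNReal.Tendsto.mul_const (hlim ω) (Or.inr hω.ne)
  · simp_rw [h.lintegral_expNeg_simpleFunc_mul _ hB]
    refine ENNReal.Tendsto.mul ?_ (Or.inr ?_) ?_ (Or.inr ?_)
    · exact tendsto_lintegral_of_dominated_convergence (fun _ => 1) hvn
        (fun n => ae_of_all _ fun ω => expNeg_le_one _)
        (by rw [lintegral_const, measure_univ]; simp) (ae_of_all _ hlim)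
    · refine ne_top_of_le_ne_top hΛB ((lintegral_mono fun x => expNeg_le_one _).trans ?_)
      simp
    · exact tendsto_lintegral_of_dominated_convergence (fun _ => 1)
        (fun n => measurable_expNeg.comp (SimpleFunc.measurable _))
        (fun n => ae_of_all _ fun ω => expNeg_le_one _) (by simpa using hΛB)
        (ae_of_all _ fun x => (continuous_expNeg.tendsto _).comp (SimpleFunc.tendsto_eapprox hv x))
    · refine ne_top_of_le_ne_top ENNReal.one_ne_top
        ((lintegral_mono fun x => expNeg_le_one _).trans ?_)
      simp

/-- The Mecke equation of a Poisson process, for the functionals `η ↦ exp (-∫ v dη)`. -/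
lemma IsPoissonProcess.lintegral_expNeg_mul [IsProbabilityMeasure P] [SigmaFinite Λ]
    (h : IsPoissonProcess P Λ η) {v f : Plane → ℝ≥0∞} (hv : Measurable v) (hf : Measurable f) :
    ∫⁻ ω, expNeg (∫⁻ x, v x ∂(η ω)) * ∫⁻ x, f x ∂(η ω) ∂P =
      (∫⁻ ω, expNeg (∫⁻ x, v x ∂(η ω)) ∂P) * ∫⁻ x, expNeg (v x) * f x ∂Λ := by
  have hX : Measurable fun ω => expNeg (∫⁻ x, v x ∂(η ω)) :=
    measurable_expNeg.comp (measurable_lintegral_comp h.measurable hv)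
  have key : (P.withDensity fun ω => expNeg (∫⁻ x, v x ∂(η ω))).bind η =
      (∫⁻ ω, expNeg (∫⁻ x, v x ∂(η ω)) ∂P) • Λ.withDensity fun x => expNeg (v x) := by
    refine ext_of_finite_sets (Λ := Λ) fun B hB hΛB => ?_
    rw [bind_withDensity_apply h.measurable hX hB, Measure.smul_apply, withDensity_apply _ hB,
      h.lintegral_expNeg_mul_apply hv hB hΛB, smul_eq_mul]
  rw [← lintegral_bind_withDensity h.measurable hX hf, key, lintegral_smul_measure,
    lintegral_withDensity_eq_lintegral_mul _ (by fun_prop) hf]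
  rfl

lemma IsPoissonProcess.lintegral_lintegral [IsProbabilityMeasure P] [SigmaFinite Λ]
    (h : IsPoissonProcess P Λ η) {f : Plane → ℝ≥0∞} (hf : Measurable f) :
    ∫⁻ ω, ∫⁻ x, f x ∂(η ω) ∂P = ∫⁻ x, f x ∂Λ := by
  have := h.lintegral_expNeg_mul (v := 0) measurable_zero hf
  simpa using this

end Poisson

end

/-! ### Conditional intensities as densities of Campbell measures. -/

section

lemma setLIntegral_preimage_eq_map {Ω T : Type*} [MeasurableSpace Ω]
    [MeasurableSpace T] {P : Measure Ω} {Z : Ω → T} (hZ : Measurable Z) {g : T → ℝ≥0∞}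
    (hg : AEMeasurable g (P.map Z)) {F : Set T} (hF : MeasurableSet F) :
    ∫⁻ ω in Z ⁻¹' F, g (Z ω) ∂P = ∫⁻ φ in F, g φ ∂(P.map Z) := by
  rw [Measure.restrict_map hZ hF, lintegral_map' _ hZ.aemeasurable]
  rw [← Measure.restrict_map hZ hF]
  exact hg.restrict

/-- For fixed `F` both sides are measures in `B`, so agreement on sets of finite volume propagates
along a countable cover. -/
lemma prod_apply_eq_of_finite_sets {Ω T : Type*} [MeasurableSpace Ω] [MeasurableSpace T]
    {P : Measure Ω} {η : Ω → Measure Plane} {Z : Ω → T} {D : Set Plane} (hη : Measurable η)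
    (hD : MeasurableSet D) {m : Measure (T × Plane)} {F : Set T}
    (h : ∀ B : Set Plane, MeasurableSet B → volume B ≠ ∞ →
      m (F ×ˢ B) = ∫⁻ ω in Z ⁻¹' F, η ω (B ∩ D) ∂P) {B : Set Plane} (hB : MeasurableSet B) :
    m (F ×ˢ B) = ∫⁻ ω in Z ⁻¹' F, η ω (B ∩ D) ∂P := by
  have h1 : ∀ C, MeasurableSet C → (m.restrict (F ×ˢ univ)).map Prod.snd C = m (F ×ˢ C) := by
    intro C hC
    rw [Measure.map_apply measurable_snd hC, Measure.restrict_apply (measurable_snd hC)]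
    congr 1
    ext q
    simp [and_comm]
  have h2 : ∀ C, MeasurableSet C → (((P.restrict (Z ⁻¹' F)).bind η).restrict D) C =
      ∫⁻ ω in Z ⁻¹' F, η ω (C ∩ D) ∂P := by
    intro C hC
    rw [Measure.restrict_apply hC, Measure.bind_apply (hC.inter hD) hη.aemeasurable]
  rw [← h1 B hB, ← h2 B hB]
  congr 1
  refine ext_of_finite_sets (Λ := volume) fun C hC hCf => ?_
  rw [h1 C hC, h2 C hC, h C hC hCf]

section ConditionalIntensity

variable {Ω T : Type*} [MeasurableSpace Ω] [MeasurableSpace T] {P : Measure Ω}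
  [IsProbabilityMeasure P] {η : Ω → Measure Plane} {Z : Ω → T} {D : Set Plane}
  {lam : T → Plane → ℝ≥0∞}

lemma withDensity_prod_apply (hZ : Measurable Z)
    (hlam : AEMeasurable (fun q : T × Plane => lam q.1 q.2) ((P.map Z).prod (volume.restrict D)))
    {F : Set T} (hF : MeasurableSet F) {B : Set Plane} (hB : MeasurableSet B) :
    ((P.map Z).prod (volume.restrict D)).withDensity (fun q => lam q.1 q.2) (F ×ˢ B) =
      ∫⁻ ω in Z ⁻¹' F, (∫⁻ x in B ∩ D, lam (Z ω) x) ∂P := by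
  have := Measure.isProbabilityMeasure_map (μ := P) hZ.aemeasurable
  have h1 : AEMeasurable (fun q : T × Plane => lam q.1 q.2)
      ((P.map Z).prod (volume.restrict (B ∩ D))) := by
    refine hlam.mono_measure ?_
    rw [← Measure.restrict_restrict hB]
    exact Measure.prod_mono le_rfl Measure.restrict_le_self
  rw [withDensity_apply _ (hF.prod hB), ← Measure.prod_restrict, Measure.restrict_restrict hB,
    lintegral_prod _ (h1.mono_measure (Measure.prod_mono Measure.restrict_le_self le_rfl)),
    setLIntegral_preimage_eq_map hZ (g := fun φ => ∫⁻ x in B ∩ D, lam φ x) _ hF]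
  exact AEMeasurable.lintegral_prod_right' h1

/-- This form turns uniqueness, change of version and existence into statements about densities with
respect to one product measure. -/
lemma isConditionalIntensity_iff (hZ : Measurable Z) (hD : MeasurableSet D) :
    IsConditionalIntensity P η Z D lam ↔
      AEMeasurable (fun q : T × Plane => lam q.1 q.2) ((P.map Z).prod (volume.restrict D)) ∧
      ∀ B : Set Plane, MeasurableSet B → ∀ F : Set T, MeasurableSet F →
        ((P.map Z).prod (volume.restrict D)).withDensity (fun q => lam q.1 q.2) (F ×ˢ B) =
          ∫⁻ ω in Z ⁻¹' F, η ω (B ∩ D) ∂P := by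
  refine and_congr_right fun hlam => ⟨fun h B hB F hF => ?_, fun h B hB hBD F hF => ?_⟩
  · rw [withDensity_prod_apply hZ hlam hF hB, h _ (hB.inter hD) inter_subset_right F hF]
  · have := h B hB F hF
    rwa [withDensity_prod_apply hZ hlam hF hB, inter_eq_left.2 hBD, eq_comm] at this

lemma ext_prod_of_finite_sets {m₁ m₂ : Measure (T × Plane)}
    (h : ∀ (F : Set T) (B : Set Plane), MeasurableSet F → MeasurableSet B → volume B ≠ ∞ →
      m₁ (F ×ˢ B) = m₂ (F ×ˢ B))
    (hfin : ∀ B : Set Plane, MeasurableSet B → volume B ≠ ∞ → m₁ (univ ×ˢ B) ≠ ∞) :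
    m₁ = m₂ := by
  let S := spanningSets (volume : Measure Plane)
  have hS : ∀ n, MeasurableSet (S n) := measurableSet_spanningSets _
  have hSf : ∀ n, volume (S n) ≠ ∞ := fun n => (measure_spanningSets_lt_top _ n).ne
  refine Measure.ext_of_iUnion_eq_univ (s := fun n => univ ×ˢ S n) ?_ fun n => ?_
  · rw [← prod_iUnion, iUnion_spanningSets, univ_prod_univ]
  · have : IsFiniteMeasure (m₁.restrict (univ ×ˢ S n)) :=
      ⟨by rw [Measure.restrict_apply_univ]; exact (hfin _ (hS n) (hSf n)).lt_top⟩
    refine Measure.ext_prod fun {F B} hF hB => ?_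
    rw [Measure.restrict_apply (hF.prod hB), Measure.restrict_apply (hF.prod hB), prod_inter_prod,
      inter_univ]
    exact h _ _ hF (hB.inter (hS n))
      ((measure_mono inter_subset_right).trans_lt (hSf n).lt_top).ne

/-- Two conditional intensities of the same point process agree almost everywhere. -/
lemma IsConditionalIntensity.ae_eq {lam' : T → Plane → ℝ≥0∞} (hZ : Measurable Z)
    (hD : MeasurableSet D)
    (hfin : ∀ B, MeasurableSet B → volume B ≠ ∞ → ∫⁻ ω, η ω B ∂P ≠ ∞)
    (h : IsConditionalIntensity P η Z D lam) (h' : IsConditionalIntensity P η Z D lam') :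
    ∀ᵐ φ ∂(P.map Z), ∀ᵐ x ∂(volume.restrict D), lam φ x = lam' φ x := by
  have := Measure.isProbabilityMeasure_map (μ := P) hZ.aemeasurable
  rw [isConditionalIntensity_iff hZ hD] at h h'
  refine Measure.ae_ae_of_ae_prod ((withDensity_eq_iff_of_sigmaFinite h.1 h'.1).1
    (ext_prod_of_finite_sets (fun F B hF hB _ => ?_) fun B hB hBf => ?_))
  · rw [h.2 B hB F hF, h'.2 B hB F hF]
  · rw [h.2 B hB univ MeasurableSet.univ]
    refine ne_top_of_le_ne_top (hfin B hB hBf) ?_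
    simpa using lintegral_mono fun ω => measure_mono inter_subset_left

lemma IsConditionalIntensity.congr {lam' : T → Plane → ℝ≥0∞} (hZ : Measurable Z)
    (hD : MeasurableSet D) (h : IsConditionalIntensity P η Z D lam)
    (hll : ∀ᵐ φ ∂(P.map Z), ∀ x, lam φ x = lam' φ x) :
    IsConditionalIntensity P η Z D lam' := by
  have hprod : (fun q : T × Plane => lam q.1 q.2) =ᵐ[(P.map Z).prod (volume.restrict D)]
      fun q => lam' q.1 q.2 := by
    filter_upwards [Measure.quasiMeasurePreserving_fst.ae hll] with q hq using hq q.2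
  rw [isConditionalIntensity_iff hZ hD] at h ⊢
  exact ⟨h.1.congr hprod, by rw [← withDensity_congr_ae hprod]; exact h.2⟩

/-- A conditional intensity exists, and can be taken measurable, as soon as the joint measure of
the conditioning variable and the points is absolutely continuous. -/
lemma exists_isConditionalIntensity (hZ : Measurable Z) (hD : MeasurableSet D)
    (m : Measure (T × Plane)) [SFinite m]
    (hm : ∀ B : Set Plane, MeasurableSet B → ∀ F : Set T, MeasurableSet F →
      m (F ×ˢ B) = ∫⁻ ω in Z ⁻¹' F, η ω (B ∩ D) ∂P)
    (hac : m ≪ (P.map Z).prod (volume.restrict D)) :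
    ∃ lam : T → Plane → ℝ≥0∞, Measurable (fun q : T × Plane => lam q.1 q.2) ∧
      IsConditionalIntensity P η Z D lam := by
  have := Measure.isProbabilityMeasure_map (μ := P) hZ.aemeasurable
  refine ⟨fun φ x => m.rnDeriv ((P.map Z).prod (volume.restrict D)) (φ, x),
    Measure.measurable_rnDeriv _ _, ?_⟩
  rw [isConditionalIntensity_iff hZ hD]
  refine ⟨(Measure.measurable_rnDeriv _ _).aemeasurable, fun B hB F hF => ?_⟩
  rw [← hm B hB F hF]
  exact congrArg (fun m : Measure (T × Plane) => m (F ×ˢ B)) (Measure.withDensity_rnDeriv_eq _ _ hac)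

end ConditionalIntensity

/-! ### Conditional laws and their mean measures. -/

section ConditionalLaw

variable {Ω T : Type*} [MeasurableSpace Ω] [MeasurableSpace T] {P : Measure Ω}
  [IsProbabilityMeasure P] {Ψ : Ω → Measure Plane} {Z : Ω → T} {A : Set Plane}
  {K : Kernel T (Measure Plane)} {ρ : T → Plane → ℝ≥0∞}

lemma setLIntegral_lintegral_of_hasCondDistrib [IsMarkovKernel K] (hZ : Measurable Z)
    (hK : HasCondDistrib (fun ω => (Ψ ω).restrict A) Z K P)
    {g : Measure Plane → ℝ≥0∞} (hg : Measurable g) {F : Set T} (hF : MeasurableSet F) :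
    ∫⁻ φ in F, ∫⁻ ψ, g ψ ∂(K φ) ∂(P.map Z) = ∫⁻ ω in Z ⁻¹' F, g ((Ψ ω).restrict A) ∂P := by
  have := Measure.isProbabilityMeasure_map (μ := P) hZ.aemeasurable
  have hg' : Measurable fun q : T × Measure Plane => g q.2 := hg.comp measurable_snd
  have h := Measure.setLIntegral_compProd (μ := P.map Z) (κ := K) hg' hF MeasurableSet.univ
  simp only [Measure.restrict_univ] at h
  rw [← h, ← HasLaw.map_eq hK, ← lintegral_indicator (hF.prod MeasurableSet.univ),
    lintegral_map' (hg'.indicator (hF.prod MeasurableSet.univ)).aemeasurable hK.aemeasurable,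
    ← lintegral_indicator (hZ hF)]
  refine lintegral_congr fun ω => ?_
  by_cases hω : Z ω ∈ F <;> simp [indicator, hω]

/-- The mean measure of the conditional law has the conditional intensity as its density. -/
lemma join_restrict_eq_withDensity [IsMarkovKernel K] (hZ : Measurable Z)
    (hA : MeasurableSet A) (hfin : ∀ B, MeasurableSet B → volume B ≠ ∞ → ∫⁻ ω, Ψ ω B ∂P ≠ ∞)
    (hK : HasCondDistrib (fun ω => (Ψ ω).restrict A) Z K P)
    (hρ : IsConditionalIntensity P Ψ Z A ρ) :
    ∀ᵐ φ ∂(P.map Z),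
      (K φ).join.restrict A = (volume.restrict A).withDensity (ρ φ) := by
  have := Measure.isProbabilityMeasure_map (μ := P) hZ.aemeasurable
  let S := spanningSets (volume : Measure Plane)
  have hS : ∀ n, MeasurableSet (S n) := measurableSet_spanningSets _
  -- For a fixed set the two masses agree almost surely. A countable generating algebra, cut by
  -- countably many sets of almost surely finite mass, allows one null set to serve for all Borel
  -- sets.
  let C := generateSetAlgebra (MeasurableSpace.countableGeneratingSet Plane)
  have hCc : C.Countable :=
    countable_generateSetAlgebra MeasurableSpace.countable_countableGeneratingSet
  have hCgen : (inferInstance : MeasurableSpace Plane) = MeasurableSpace.generateFrom C := by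
    rw [generateFrom_generateSetAlgebra_eq, MeasurableSpace.generateFrom_countableGeneratingSet]
  have hCalg : IsSetAlgebra C := isSetAlgebra_generateSetAlgebra
  have hCm : ∀ B ∈ C, MeasurableSet B := fun B hB => by
    have := MeasurableSpace.measurableSet_generateFrom hB
    rwa [← hCgen] at this
  have hmeas : ∀ B, MeasurableSet B → Measurable fun φ => (K φ).join B := fun B hB =>
    (Measure.measurable_coe hB).comp (Measure.measurable_join.comp K.measurable)
  have hset : ∀ B, MeasurableSet B → ∀ F, MeasurableSet F →
      ∫⁻ φ in F, (K φ).join (B ∩ A) ∂(P.map Z) = ∫⁻ ω in Z ⁻¹' F, Ψ ω (B ∩ A) ∂P := by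
    intro B hB F hF
    simp_rw [Measure.join_apply (hB.inter hA)]
    rw [setLIntegral_lintegral_of_hasCondDistrib hZ hK
      (Measure.measurable_coe (hB.inter hA)) hF]
    refine lintegral_congr fun ω => ?_
    rw [Measure.restrict_apply (hB.inter hA), inter_assoc, inter_self]
  have hρm : ∀ B, MeasurableSet B →
      AEMeasurable (fun φ => ∫⁻ x in B ∩ A, ρ φ x) (P.map Z) := by
    intro B hB
    refine AEMeasurable.lintegral_prod_right' (f := fun q : T × Plane => ρ q.1 q.2)
      (hρ.1.mono_measure (Measure.prod_mono le_rfl ?_))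
    exact Measure.restrict_mono inter_subset_right le_rfl
  have hae : ∀ B, MeasurableSet B → ∀ᵐ φ ∂(P.map Z),
      (K φ).join (B ∩ A) = ∫⁻ x in B ∩ A, ρ φ x := by
    intro B hB
    refine ae_eq_of_forall_setLIntegral_eq_of_sigmaFinite₀
      (hmeas _ (hB.inter hA)).aemeasurable (hρm B hB) fun F hF _ => ?_
    rw [hset B hB F hF, hρ.2 _ (hB.inter hA) inter_subset_right F hF,
      setLIntegral_preimage_eq_map hZ (hρm B hB) hF]
  have hfinite : ∀ n, ∀ᵐ φ ∂(P.map Z), (K φ).join (S n ∩ A) < ∞ := by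
    intro n
    refine ae_lt_top (hmeas _ ((hS n).inter hA)) ?_
    have := hset (S n) (hS n) univ MeasurableSet.univ
    simp only [Measure.restrict_univ, preimage_univ] at this
    rw [this]
    exact ne_top_of_le_ne_top (hfin (S n) (hS n) (measure_spanningSets_lt_top _ n).ne)
      (lintegral_mono fun ω => measure_mono inter_subset_left)
  have hall : ∀ᵐ φ ∂(P.map Z), ∀ n, ∀ B ∈ C, (K φ).join (B ∩ S n ∩ A) =
      ∫⁻ x in B ∩ S n ∩ A, ρ φ x :=
    ae_all_iff.2 fun n => (ae_ball_iff hCc).2 fun B hB => hae _ ((hCm B hB).inter (hS n))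
  filter_upwards [hall, ae_all_iff.2 hfinite] with φ h1 h2
  refine Measure.ext_of_generateFrom_of_cover (T := range S) hCgen (countable_range S)
    (fun s hs t ht _ => hCalg.inter_mem hs ht) ?_ ?_ ?_ ?_
  · rw [sUnion_range, iUnion_spanningSets]
  · rintro _ ⟨n, rfl⟩
    rw [Measure.restrict_apply (hS n)]
    exact (h2 n).ne
  · rintro _ ⟨n, rfl⟩ B hB
    have hBS := (hCm B hB).inter (hS n)
    rw [Measure.restrict_apply hBS, withDensity_apply _ hBS, Measure.restrict_restrict hBS]
    exact h1 n B hB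
  · rintro _ ⟨n, rfl⟩
    rw [Measure.restrict_apply (hS n), withDensity_apply _ (hS n),
      Measure.restrict_restrict (hS n)]
    have := h1 n univ hCalg.univ_mem
    rwa [univ_inter] at this

/-- The conditional expectation of a sum over the points, as an integral against the conditional
intensity. -/
lemma lintegral_condLaw_eq [IsMarkovKernel K] (hZ : Measurable Z)
    (hA : MeasurableSet A) (hfin : ∀ B, MeasurableSet B → volume B ≠ ∞ → ∫⁻ ω, Ψ ω B ∂P ≠ ∞)
    (hK : HasCondDistrib (fun ω => (Ψ ω).restrict A) Z K P)
    (hρ : IsConditionalIntensity P Ψ Z A ρ) :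
    ∀ᵐ φ ∂(P.map Z), ∀ f : Plane → ℝ≥0∞, Measurable f →
      ∫⁻ ψ, ∫⁻ y in A, f y ∂ψ ∂(K φ) = ∫⁻ y in A, f y * ρ φ y := by
  have := Measure.isProbabilityMeasure_map (μ := P) hZ.aemeasurable
  have hρφ : ∀ᵐ φ ∂(P.map Z), AEMeasurable (ρ φ) (volume.restrict A) := by
    filter_upwards [Measure.ae_ae_of_ae_prod hρ.1.ae_eq_mk] with φ hφ
    exact ⟨_, hρ.1.measurable_mk.comp measurable_prodMk_left, hφ⟩
  filter_upwards [join_restrict_eq_withDensity hZ hA hfin hK hρ, hρφ] with φ h1 h2 f hf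
  -- The inner expectation is an integral against the mean measure, whose density is `ρ φ`. The null
  -- set was fixed before `f`, hence the statement for all `f` at once.
  simp_rw [← lintegral_indicator hA]
  rw [← Measure.lintegral_join (hf.indicator hA).aemeasurable, lintegral_indicator hA, h1,
    lintegral_withDensity_eq_lintegral_mul₀ h2 hf.aemeasurable, lintegral_indicator hA]
  exact lintegral_congr fun y => mul_comm _ _

end ConditionalLaw

end

/-! ### Comparison of weighted laws by Laplace functionals. -/

section

/-- Weighted laws of random measures agree if their Laplace functionals do. -/
lemma setLIntegral_preimage_eq_of_laplace {α Ω₁ Ω₂ : Type*} [MeasurableSpace α]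
    [MeasurableSpace Ω₁] [MeasurableSpace Ω₂] {P₁ : Measure Ω₁} {P₂ : Measure Ω₂}
    {Z₁ : Ω₁ → Measure α} {Z₂ : Ω₂ → Measure α} (hZ₁ : Measurable Z₁) (hZ₂ : Measurable Z₂)
    {X₁ : Ω₁ → ℝ≥0∞} {X₂ : Ω₂ → ℝ≥0∞} (hX₁ : Measurable X₁) (hX₂ : Measurable X₂)
    (hfin : ∫⁻ ω, X₁ ω ∂P₁ ≠ ∞)
    (h : ∀ u : α → ℝ≥0∞, Measurable u →
      ∫⁻ ω, expNeg (∫⁻ x, u x ∂(Z₁ ω)) * X₁ ω ∂P₁ = ∫⁻ ω, expNeg (∫⁻ x, u x ∂(Z₂ ω)) * X₂ ω ∂P₂)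
    {F : Set (Measure α)} (hF : MeasurableSet F) :
    ∫⁻ ω in Z₁ ⁻¹' F, X₁ ω ∂P₁ = ∫⁻ ω in Z₂ ⁻¹' F, X₂ ω ∂P₂ := by
  have hfin₂ : ∫⁻ ω, X₂ ω ∂P₂ ≠ ∞ := by
    have := h 0 measurable_zero
    simp only [Pi.zero_apply, lintegral_zero, expNeg_zero, one_mul] at this
    rwa [← this]
  have := isFiniteMeasure_withDensity hfin
  have := isFiniteMeasure_withDensity hfin₂
  have key : (P₁.withDensity X₁).map Z₁ = (P₂.withDensity X₂).map Z₂ := by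
    refine ext_of_laplace _ _ fun u hu _ => ?_
    have hu' : Measurable fun η : Measure α => expNeg (∫⁻ x, u x ∂η) :=
      measurable_expNeg.comp (Measure.measurable_lintegral hu)
    have h₁ : Measurable fun ω => expNeg (∫⁻ x, u x ∂(Z₁ ω)) := hu'.comp hZ₁
    have h₂ : Measurable fun ω => expNeg (∫⁻ x, u x ∂(Z₂ ω)) := hu'.comp hZ₂
    rw [lintegral_map hu' hZ₁, lintegral_map hu' hZ₂,
      lintegral_withDensity_eq_lintegral_mul _ hX₁ h₁,
      lintegral_withDensity_eq_lintegral_mul _ hX₂ h₂]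
    simp only [Pi.mul_apply, mul_comm (X₁ _), mul_comm (X₂ _)]
    exact h u hu
  rw [← withDensity_apply _ (hZ₁ hF), ← withDensity_apply _ (hZ₂ hF), ← Measure.map_apply hZ₁ hF,
    ← Measure.map_apply hZ₂ hF, key]

lemma measurable_restrict_comp {α Ω : Type*} [MeasurableSpace α] [MeasurableSpace Ω]
    {η : Ω → Measure α} (hη : Measurable η) {W : Set α} (hW : MeasurableSet W) :
    Measurable fun ω => (η ω).restrict W := by
  refine Measure.measurable_of_measurable_coe _ fun B hB => ?_
  simp_rw [Measure.restrict_apply hB]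
  exact measurable_apply_comp hη (hB.inter hW)

instance sigmaFinite_smul_volume (κ : ℝ≥0) :
    SigmaFinite ((κ : ℝ≥0∞) • (volume : Measure Plane)) :=
  inferInstanceAs (SigmaFinite (κ • (volume : Measure Plane)))

/-- The joint law of `Z + C y` and `y`, for independent `Z` and `C`, and `y` distributed according
to `Λ`. -/
def jointLaw {Ω : Type*} [MeasurableSpace Ω] (P : Measure Ω) (Λ : Measure Plane)
    (Z : Ω → Measure Plane) (C : Ω × Plane → Measure Plane) : Measure (Measure Plane × Plane) :=
  ((P.prod P).prod Λ).map fun q => (Z q.1.1 + C (q.1.2, q.2), q.2)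

section JointLaw

variable {Ω : Type*} [MeasurableSpace Ω] {P : Measure Ω} [SFinite P] {Λ : Measure Plane}
  [SFinite Λ] {Z : Ω → Measure Plane} {C : Ω × Plane → Measure Plane}

lemma measurable_add_measure {α β : Type*} [MeasurableSpace α] [MeasurableSpace β]
    {η ζ : α → Measure β} (hη : Measurable η) (hζ : Measurable ζ) :
    Measurable fun a => η a + ζ a := by
  refine Measure.measurable_of_measurable_coe _ fun B hB => ?_
  simp only [Measure.add_apply]
  exact (measurable_apply_comp hη hB).add (measurable_apply_comp hζ hB)

lemma measurable_jointLaw (hZ : Measurable Z) (hC : Measurable C) :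
    Measurable fun q : (Ω × Ω) × Plane => Z q.1.1 + C (q.1.2, q.2) :=
  measurable_add_measure (η := fun q : (Ω × Ω) × Plane => Z q.1.1)
    (ζ := fun q : (Ω × Ω) × Plane => C (q.1.2, q.2)) (by fun_prop) (by fun_prop)

/-- Independence factors the Laplace functional of `Z + C y` for fixed `y`, which is the product
form assumed in `h`. Weighted laws on two different base spaces are compared, the second carrying
the factor `Λ`. -/
lemma jointLaw_apply (hZ : Measurable Z) (hC : Measurable C) {X : Ω → ℝ≥0∞} (hX : Measurable X)
    (hXf : ∫⁻ ω, X ω ∂P ≠ ∞) {B : Set Plane} (hB : MeasurableSet B)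
    (h : ∀ u : Plane → ℝ≥0∞, Measurable u →
      ∫⁻ ω, expNeg (∫⁻ x, u x ∂(Z ω)) * X ω ∂P =
        (∫⁻ ω, expNeg (∫⁻ x, u x ∂(Z ω)) ∂P) *
          ∫⁻ y in B, ∫⁻ ω, expNeg (∫⁻ x, u x ∂(C (ω, y))) ∂P ∂Λ)
    {F : Set (Measure Plane)} (hF : MeasurableSet F) :
    jointLaw P Λ Z C (F ×ˢ B) = ∫⁻ ω in Z ⁻¹' F, X ω ∂P := by
  have hZC := measurable_jointLaw hZ hC
  let Y : (Ω × Ω) × Plane → ℝ≥0∞ := fun q => B.indicator 1 q.2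
  have hY : Measurable Y := (measurable_one.indicator hB).comp measurable_snd
  rw [setLIntegral_preimage_eq_of_laplace hZ hZC hX hY hXf ?_ hF]
  · rw [jointLaw, Measure.map_apply (hZC.prodMk measurable_snd) (hF.prod hB),
      ← lintegral_indicator (hZC hF), ← lintegral_indicator_one
        ((hZC.prodMk measurable_snd) (hF.prod hB))]
    refine lintegral_congr fun q => ?_
    by_cases h1 : Z q.1.1 + C (q.1.2, q.2) ∈ F <;> by_cases h2 : q.2 ∈ B <;>
      simp [indicator, Y, h1, h2]
  intro u hu
  rw [h u hu]
  have hu' : Measurable fun η : Measure Plane => expNeg (∫⁻ x, u x ∂η) :=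
    measurable_expNeg.comp (Measure.measurable_lintegral hu)
  have hE : Measurable fun ω => expNeg (∫⁻ x, u x ∂(Z ω)) := hu'.comp hZ
  have hG : Measurable fun q : Ω × Plane => expNeg (∫⁻ x, u x ∂(C q)) := hu'.comp hC
  generalize hEe : (fun ω => expNeg (∫⁻ x, u x ∂(Z ω))) = E at hE
  generalize hGe : (fun q : Ω × Plane => expNeg (∫⁻ x, u x ∂(C q))) = G at hG
  have hEe' : ∀ ω, expNeg (∫⁻ x, u x ∂(Z ω)) = E ω := fun ω => congrFun hEe ω
  have hGe' : ∀ q, expNeg (∫⁻ x, u x ∂(C q)) = G q := fun q => congrFun hGe q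
  simp_rw [lintegral_add_measure, expNeg_add, hEe', hGe']
  rw [lintegral_prod_symm _ (by fun_prop), ← lintegral_const_mul _ (by fun_prop),
    ← lintegral_indicator hB]
  refine lintegral_congr fun y => ?_
  dsimp only [Y]
  rw [lintegral_mul_const _ (by fun_prop), lintegral_prod_mul (f := E) (g := fun ω => G (ω, y))
    (by fun_prop) (by fun_prop)]
  by_cases hy : y ∈ B <;> simp [hy]

end JointLaw

section Disperse

variable {p k : Plane → ℝ≥0} {W : Set Plane} {r : ℝ}

/-- By Tonelli and evenness, the kernel integrates to `1` in the parent variable. This gives finite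
expected numbers of offspring in sets of finite volume. -/
lemma lintegral_disperse_le (hk : Measurable k) (hk_int : ∫⁻ z, (k z : ℝ≥0∞) = 1)
    (hk_even : ∀ z, k (-z) = k z) (hp : Measurable p)
    (hp_le : ∀ x, p x ≤ 1) {f : Plane → ℝ≥0∞} (hf : Measurable f) :
    ∫⁻ y, disperse k p f y ≤ ∫⁻ x, f x := by
  simp_rw [disperse]
  rw [lintegral_lintegral_swap (by fun_prop)]
  refine lintegral_mono fun x => ?_
  have hx : ∀ y, (p x : ℝ≥0∞) * k (x - y) * f x = p x * f x * k (y - x) := fun y => by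
    rw [← hk_even, neg_sub]; ring
  simp_rw [hx]
  rw [lintegral_const_mul _ (by fun_prop),
    lintegral_sub_right_eq_self (fun z => (k z : ℝ≥0∞)), hk_int, mul_one]
  have : (p x : ℝ≥0∞) ≤ 1 := by exact_mod_cast hp_le x
  exact mul_le_of_le_one_left' this

/-- Parents outside `W_{⊕r}` have no offspring in `W`. -/
lemma mul_kernel_eq_zero (hk_supp : ∀ z, r < ‖z‖ → k z = 0) {x y : Plane} (hx : x ∈ W)
    (hy : y ∉ W ∪ border W r) : k (x - y) = 0 := by
  refine hk_supp _ (lt_of_not_ge fun h => hy ?_)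
  by_cases hyW : y ∈ W
  · exact Or.inl hyW
  · refine Or.inr ⟨⟨x, hx, y - x, ?_, by simp⟩, hyW⟩
    rwa [mem_closedBall_zero_iff, norm_sub_rev]

lemma disperse_indicator_eq_zero (hk_supp : ∀ z, r < ‖z‖ → k z = 0) (u : Plane → ℝ≥0∞)
    {y : Plane} (hy : y ∉ W ∪ border W r) :
    disperse k p (fun x => 1 - expNeg (W.indicator u x)) y = 0 := by
  rw [disperse, ← lintegral_zero (μ := (volume : Measure Plane))]
  congr 1
  ext x
  by_cases hx : x ∈ W
  · simp [mul_kernel_eq_zero hk_supp hx hy]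
  · simp [hx]

end Disperse

section NeymanScott

variable {p k : Plane → ℝ≥0} {Ω : Type*} [MeasurableSpace Ω] {P : Measure Ω}
  {κ μ : ℝ≥0}
  {parent : ℕ → Ω → Plane} {number : ℕ → Ω → ℕ} {shift : ℕ → ℕ → Ω → Plane}
  {mark : ℕ → ℕ → Ω → ℝ} {W : Set Plane} {r : ℝ}

lemma measurable_thinnedProcess (hNS : IsNeymanScott P κ μ k parent number shift mark)
    (hp : Measurable p) : Measurable (thinnedProcess p parent number shift mark) := by
  have : thinnedProcess p parent number shift mark = fun ω =>
      clusterSum p (fun i => parent i ω) (fun i => clusterVar number shift mark i ω) := by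
    ext1 ω
    exact thinnedProcess_eq_clusterSum parent number shift mark ω
  rw [this]
  exact (measurable_clusterSum hp).comp
    (f := fun ω => (fun i => parent i ω, fun i => clusterVar number shift mark i ω))
    ((measurable_pi_lambda _ hNS.measurable_parent).prodMk
      (measurable_pi_lambda _ (measurable_clusterVar hNS)))

lemma lintegral_thinnedProcess_ne_top [IsProbabilityMeasure P]
    (hNS : IsNeymanScott P κ μ k parent number shift mark)
    (hk : Measurable k) (hk_int : ∫⁻ z, (k z : ℝ≥0∞) = 1) (hk_even : ∀ z, k (-z) = k z)
    (hp : Measurable p) (hp_le : ∀ x, p x ≤ 1) {B : Set Plane} (hB : MeasurableSet B)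
    (hBf : volume B ≠ ∞) : ∫⁻ ω, thinnedProcess p parent number shift mark ω B ∂P ≠ ∞ := by
  have hf : Measurable (B.indicator (1 : Plane → ℝ≥0∞)) := measurable_one.indicator hB
  have h := lintegral_expNeg_mul_thinnedProcess hNS hk hk_int hp hp_le (u := 0) measurable_zero hf
    fun x => by by_cases hx : x ∈ B <;> simp [hx]
  simp only [Pi.zero_apply, lintegral_zero, expNeg_zero, one_mul, lintegral_indicator_one hB,
    tsub_self] at h
  have h0 : disperse k p (fun _ => 0) = fun _ => 0 := by ext y; simp [disperse]
  simp only [h0, mul_zero, lintegral_zero, expNeg_zero, one_mul] at h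
  rw [h, hNS.parent_law.lintegral_lintegral ((measurable_disperse hp hk hf).const_mul _),
    lintegral_smul_measure, lintegral_const_mul _ (measurable_disperse hp hk hf)]
  refine ENNReal.mul_ne_top ENNReal.coe_ne_top (ENNReal.mul_ne_top ENNReal.coe_ne_top ?_)
  refine ne_top_of_le_ne_top hBf ((lintegral_disperse_le hk hk_int hk_even hp hp_le hf).trans ?_)
  rw [lintegral_indicator_one hB]

lemma lintegral_parentProcess_ne_top [IsProbabilityMeasure P]
    (hNS : IsNeymanScott P κ μ k parent number shift mark) {B : Set Plane} (hB : MeasurableSet B)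
    (hBf : volume B ≠ ∞) : ∫⁻ ω, parentProcess parent ω B ∂P ≠ ∞ := by
  rw [hNS.parent_law.lintegral_count hB]
  exact ENNReal.mul_ne_top ENNReal.coe_ne_top hBf

/-- Given the observation in `W`, the offspring in a set `B` disjoint from `W` have the same
expected number as if they were scattered from the parents in `W_{⊕r}` and from an independent
homogeneous parent process elsewhere. -/
lemma setLIntegral_thinnedProcess [IsProbabilityMeasure P]
    (hNS : IsNeymanScott P κ μ k parent number shift mark)
    (hk : Measurable k) (hk_int : ∫⁻ z, (k z : ℝ≥0∞) = 1) (hk_supp : ∀ z, r < ‖z‖ → k z = 0)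
    (hk_even : ∀ z, k (-z) = k z) (hp : Measurable p) (hp_le : ∀ x, p x ≤ 1)
    (hW : MeasurableSet W) (hA : MeasurableSet (W ∪ border W r)) {B : Set Plane}
    (hB : MeasurableSet B) (hBf : volume B ≠ ∞) (hBW : B ⊆ Wᶜ) {F : Set (Measure Plane)}
    (hF : MeasurableSet F) :
    ∫⁻ ω in (fun ω => (thinnedProcess p parent number shift mark ω).restrict W) ⁻¹' F,
        thinnedProcess p parent number shift mark ω B ∂P =
      ∫⁻ ω in (fun ω => (thinnedProcess p parent number shift mark ω).restrict W) ⁻¹' F,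
        (∫⁻ y in W ∪ border W r, μ * disperse k p (B.indicator 1) y ∂(parentProcess parent ω) +
          κ * ∫⁻ y in (W ∪ border W r)ᶜ, μ * disperse k p (B.indicator 1) y) ∂P := by
  set A := W ∪ border W r
  have hf : Measurable (B.indicator (1 : Plane → ℝ≥0∞)) := measurable_one.indicator hB
  have hw : Measurable fun y => μ * disperse k p (B.indicator 1) y :=
    (measurable_disperse hp hk hf).const_mul _
  have hΦ := measurable_thinnedProcess hNS hp
  have hΨ := hNS.parent_law.measurable
  have hZ := measurable_restrict_comp hΦ hW
  have hX : Measurable fun ω =>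
      ∫⁻ y in A, μ * disperse k p (B.indicator 1) y ∂(parentProcess parent ω) :=
    measurable_lintegral_comp (measurable_restrict_comp hΨ hA) hw
  refine setLIntegral_preimage_eq_of_laplace hZ hZ (measurable_apply_comp hΦ hB)
    (hX.add_const _) (lintegral_thinnedProcess_ne_top hNS hk hk_int hk_even hp hp_le hB hBf) ?_ hF
  intro u hu
  have huW : Measurable (W.indicator u) := hu.indicator hW
  have hv : Measurable fun y => μ * disperse k p (fun x => 1 - expNeg (W.indicator u x)) y :=
    (measurable_disperse hp hk (by fun_prop)).const_mul _
  -- A parent outside `A` has no offspring in `W`, hence no effect on the observation.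
  have hv0 : ∀ y ∉ A, expNeg (μ * disperse k p (fun x => 1 - expNeg (W.indicator u x)) y) = 1 :=
    fun y hy => by rw [disperse_indicator_eq_zero hk_supp u hy, mul_zero, expNeg_zero]
  -- The test function lives on `W` and `B` avoids `W`, so the exponential does not reweight the
  -- points counted in `B`.
  have hfu : (fun x => expNeg (W.indicator u x) * B.indicator (1 : Plane → ℝ≥0∞) x) =
      B.indicator 1 := by
    ext x
    by_cases hx : x ∈ B
    · have hxW : x ∉ W := hBW hx
      simp only [indicator_of_notMem hxW, expNeg_zero, one_mul]
    · simp only [indicator_of_notMem hx, mul_zero]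
  have h1 := lintegral_expNeg_mul_thinnedProcess hNS hk hk_int hp hp_le huW hf
    fun x => by by_cases hx : x ∈ B <;> simp [hx]
  rw [hfu, hNS.parent_law.lintegral_expNeg_mul hv hw] at h1
  have h2 := lintegral_expNeg_thinnedProcess hNS hk hp hp_le huW (hw.indicator hA)
    (κ * ∫⁻ y in Aᶜ, μ * disperse k p (B.indicator 1) y)
  simp only [lintegral_indicator hA] at h2
  simp_rw [← lintegral_indicator hW]
  simp only [lintegral_indicator_one hB] at h1
  have hE : Measurable fun ω => expNeg (∫⁻ y,
      μ * disperse k p (fun x => 1 - expNeg (W.indicator u x)) y ∂(parentProcess parent ω)) :=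
    measurable_expNeg.comp (measurable_lintegral_comp hΨ hv)
  -- The Mecke equation is applied to the parents in `A` alone; compared with `h1`, only the
  -- integral over the complement of `A` remains.
  have h3 := hNS.parent_law.lintegral_expNeg_mul hv (hw.indicator hA)
  simp_rw [lintegral_indicator hA] at h3
  rw [h1, h2]
  simp_rw [mul_add]
  have hEX : Measurable fun ω => expNeg (∫⁻ y,
      μ * disperse k p (fun x => 1 - expNeg (W.indicator u x)) y ∂(parentProcess parent ω)) *
      ∫⁻ y in A, μ * disperse k p (B.indicator 1) y ∂(parentProcess parent ω) := hE.mul hX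
  rw [lintegral_add_left hEX, lintegral_mul_const _ hE, h3, ← mul_add]
  congr 1
  rw [← lintegral_add_compl _ hA]
  simp only [Measure.restrict_smul, lintegral_smul_measure]
  rw [← lintegral_indicator hA]
  congr 1
  · rw [smul_eq_mul, smul_eq_mul]
    congr 1
    refine lintegral_congr fun y => ?_
    by_cases hy : y ∈ A <;> simp [hy]
  · rw [smul_eq_mul]
    congr 1
    refine setLIntegral_congr_fun hA.compl fun y hy => ?_
    rw [hv0 y hy, one_mul]

lemma measurable_cluster_clusterVar (hNS : IsNeymanScott P κ μ k parent number shift mark)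
    (hp : Measurable p) (hW : MeasurableSet W) : Measurable fun q : Ω × Plane =>
      (cluster p q.2 (clusterVar number shift mark 0 q.1)).restrict W := by
  have h0 := measurable_clusterVar hNS 0
  exact measurable_restrict_comp ((measurable_cluster hp).comp
      (f := fun q : Ω × Plane => (q.2, clusterVar number shift mark 0 q.1)) (by fun_prop)) hW

/-- The joint law of the observation and of a parent: by the Mecke equation, a parent at `y`
contributes an independent cluster around `y` to the observation. -/
lemma jointLaw_cluster_apply [IsProbabilityMeasure P]
    (hNS : IsNeymanScott P κ μ k parent number shift mark)
    (hk : Measurable k) (hp : Measurable p) (hp_le : ∀ x, p x ≤ 1)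
    (hW : MeasurableSet W) {A : Set Plane} (hA : MeasurableSet A) {B : Set Plane}
    (hB : MeasurableSet B) (hBf : volume B ≠ ∞) {F : Set (Measure Plane)}
    (hF : MeasurableSet F) :
    jointLaw P ((κ : ℝ≥0∞) • (volume : Measure Plane).restrict A)
        (fun ω => (thinnedProcess p parent number shift mark ω).restrict W)
        (fun q => (cluster p q.2 (clusterVar number shift mark 0 q.1)).restrict W) (F ×ˢ B) =
      ∫⁻ ω in (fun ω => (thinnedProcess p parent number shift mark ω).restrict W) ⁻¹' F,
        parentProcess parent ω (B ∩ A) ∂P := by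
  have hΨ := hNS.parent_law.measurable
  have hBA := hB.inter hA
  have hBAf : volume (B ∩ A) ≠ ∞ :=
    ((measure_mono inter_subset_left).trans_lt hBf.lt_top).ne
  refine jointLaw_apply (measurable_restrict_comp (measurable_thinnedProcess hNS hp) hW)
    (measurable_cluster_clusterVar hNS hp hW) (measurable_apply_comp hΨ hBA)
    (lintegral_parentProcess_ne_top hNS hBA hBAf) hB (fun u hu => ?_) hF
  have huW : Measurable (W.indicator u) := hu.indicator hW
  have hv : Measurable fun y => μ * disperse k p (fun x => 1 - expNeg (W.indicator u x)) y :=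
    (measurable_disperse hp hk (by fun_prop)).const_mul _
  have hg : Measurable ((B ∩ A).indicator (1 : Plane → ℝ≥0∞)) := measurable_one.indicator hBA
  -- The additive constant separates two uses: `0` keeps only the parent count, while a zero
  -- integrand with constant `1` gives the pure Laplace functional.
  have h1 := lintegral_expNeg_thinnedProcess hNS hk hp hp_le huW hg 0
  have h0 := lintegral_expNeg_thinnedProcess hNS hk hp hp_le huW measurable_zero 1
  simp only [add_zero, lintegral_indicator_one hBA] at h1
  simp only [lintegral_zero, Pi.zero_apply, zero_add, mul_one] at h0
  have h2 := hNS.parent_law.lintegral_expNeg_mul hv hg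
  simp only [lintegral_indicator_one hBA] at h2
  rw [h2, ← h0] at h1
  simp only [← lintegral_indicator hW, h1, lintegral_expNeg_cluster hNS hk hp hp_le huW]
  congr 1
  rw [← Measure.restrict_smul, Measure.restrict_restrict hB, ← lintegral_indicator hBA]
  refine lintegral_congr fun y => ?_
  by_cases hy : y ∈ B ∩ A <;> simp only [hy, indicator_of_mem, indicator_of_notMem,
    not_false_eq_true, Pi.one_apply, mul_one, mul_zero]

end NeymanScott

end

/-! ### Absolute continuity and existence of the parent intensity. -/

section

/-- Absolute continuity with respect to a product may be tested with a larger first factor. -/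
lemma absolutelyContinuous_prod_of_fst {T β : Type*} [MeasurableSpace T] [MeasurableSpace β]
    {m : Measure (T × β)} {R q : Measure T} {ν : Measure β} [SFinite R] [SigmaFinite q] [SFinite ν]
    (h : m ≪ R.prod ν) (hq : m.map Prod.fst ≪ q) : m ≪ q.prod ν := by
  refine Measure.AbsolutelyContinuous.mk fun G hG h0 => ?_
  -- The part of `R` singular to `q` lives off `s`, and the complement of `s` is `q`-null, hence
  -- carries no mass of the first marginal of `m`. Over `s` only the part of `R` with a density with
  -- respect to `q` remains.
  obtain ⟨s, hs, hRs, hqs⟩ := Measure.mutuallySingular_singularPart R q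
  have h1 : m (sᶜ ×ˢ univ) = 0 := by
    have := hq hqs
    rwa [Measure.map_apply measurable_fst hs.compl, ← prod_univ] at this
  have h2 : m (G ∩ s ×ˢ univ) = 0 := by
    refine h ?_
    have hGs := hG.inter (hs.prod MeasurableSet.univ)
    rw [Measure.measure_prod_null hGs]
    rw [Measure.measure_prod_null hG] at h0
    rw [← Measure.singularPart_add_rnDeriv R q, EventuallyEq, ae_add_measure_iff]
    constructor
    · have : ∀ᵐ x ∂(R.singularPart q), x ∉ s := measure_eq_zero_iff_ae_notMem.1 hRs
      filter_upwards [this] with x hx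
      simp [hx]
    · filter_upwards [(withDensity_absolutelyContinuous q (R.rnDeriv q)).ae_le h0] with x hx
      exact measure_mono_null (fun y hy => hy.1) hx
  refine measure_mono_null (t := (G ∩ s ×ˢ univ) ∪ sᶜ ×ˢ univ) (fun x hx => ?_)
    (measure_union_null h2 h1)
  by_cases hxs : x.1 ∈ s
  · exact Or.inl ⟨hx, hxs, trivial⟩
  · exact Or.inr ⟨hxs, trivial⟩

lemma absolutelyContinuous_pi {E : Type*} [MeasurableSpace E] {ν₁ ν₂ : Measure E} [SigmaFinite ν₁]
    [SigmaFinite ν₂] (h : ν₁ ≪ ν₂) (n : ℕ) :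
    Measure.pi (fun _ : Fin n => ν₁) ≪ Measure.pi (fun _ : Fin n => ν₂) := by
  induction n with
  | zero => rw [Measure.pi_of_empty, Measure.pi_of_empty]
  | succ n ih =>
    have h₁ := (measurePreserving_piFinSuccAbove (fun _ : Fin (n + 1) => ν₁) 0).symm
    have h₂ := (measurePreserving_piFinSuccAbove (fun _ : Fin (n + 1) => ν₂) 0).symm
    rw [← h₁.map_eq, ← h₂.map_eq]
    exact (h.prod ih).map h₁.measurable

/-- Null sets of a product are tested by sections in `y`. The dominating measure must be the same
for all `y`. -/
lemma jointLaw_absolutelyContinuous {Ω : Type*} [MeasurableSpace Ω] {P : Measure Ω} [SFinite P]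
    {Λ : Measure Plane} [SFinite Λ] {Z : Ω → Measure Plane} {C : Ω × Plane → Measure Plane}
    (hZ : Measurable Z) (hC : Measurable C) {R : Measure (Measure Plane)} [SFinite R]
    (h : ∀ y, (P.prod P).map (fun q => Z q.1 + C (q.2, y)) ≪ R) :
    jointLaw P Λ Z C ≪ R.prod Λ := by
  have hZC := (measurable_jointLaw hZ hC).prodMk measurable_snd
  refine Measure.AbsolutelyContinuous.mk fun G hG h0 => ?_
  rw [Measure.prod_apply_symm hG,
    lintegral_eq_zero_iff (measurable_measure_prodMk_right hG)] at h0
  rw [jointLaw, Measure.map_apply hZC hG, Measure.prod_apply_symm (hZC hG),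
    lintegral_eq_zero_iff (measurable_measure_prodMk_right (hZC hG))]
  filter_upwards [h0] with y hy
  have hZy : Measurable fun q : Ω × Ω => Z q.1 + C (q.2, y) :=
    measurable_add_measure (η := fun q : Ω × Ω => Z q.1) (ζ := fun q : Ω × Ω => C (q.2, y))
      (by fun_prop) (by fun_prop)
  have := h y hy
  rwa [Measure.map_apply hZy (measurable_prodMk_right hG)] at this

/-- A finite sequence, continued by a constant. -/
def extendSeq {E : Type*} (d : E) {n : ℕ} (x : Fin n → E) (j : ℕ) : E :=
  if h : j < n then x ⟨j, h⟩ else d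

lemma measurable_extendSeq {E : Type*} [MeasurableSpace E] (d : E) (n : ℕ) :
    Measurable fun x : Fin n → E => extendSeq d x := by
  refine measurable_pi_lambda _ fun j => ?_
  by_cases h : j < n
  · simpa [extendSeq, h] using measurable_pi_apply _
  · simp [extendSeq, h]

/-- A cluster depends only on its first `n` absolute positions and their marks, so the parent can be
moved to the origin. The filler value is never read, since only indices below `n` contribute. -/
lemma cluster_eq_extendSeq (p : Plane → ℝ≥0) (y : Plane) (n : ℕ) (x : ℕ → Plane × ℝ) :
    cluster p y (n, x) =
      cluster p 0 (n, extendSeq 0 fun j : Fin n => (y + (x j).1, (x j).2)) := by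
  rw [cluster, cluster]
  congr 1
  ext1 j
  by_cases h : j < n
  · simp [extendSeq, h]
  · simp [h]

section NeymanScott

variable {p k : Plane → ℝ≥0} {Ω : Type*} [MeasurableSpace Ω] {P : Measure Ω}
  {κ μ : ℝ≥0}
  {parent : ℕ → Ω → Plane} {number : ℕ → Ω → ℕ} {shift : ℕ → ℕ → Ω → Plane}
  {mark : ℕ → ℕ → Ω → ℝ} {W A : Set Plane}

/-- The distribution of finitely many points of a cluster around `y`, with their marks, has a
density. -/
lemma map_points_absolutelyContinuous [IsProbabilityMeasure P]
    (hNS : IsNeymanScott P κ μ k parent number shift mark) (y : Plane)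
    (n : ℕ) :
    P.map (fun ω (j : Fin n) => (y + shift 0 j ω, mark 0 j ω)) ≪
      Measure.pi fun _ : Fin n => (volume : Measure Plane).prod (volume.restrict (Icc (0 : ℝ) 1)) := by
  have hS := hNS.measurable_shift
  have hM := hNS.measurable_mark
  have hm : ∀ j : Fin n, Measurable fun ω => (y + shift 0 j ω, mark 0 j ω) :=
    fun j => ((hS 0 j).const_add y).prodMk (hM 0 j)
  have hind : iIndepFun (fun (j : Fin n) ω => (y + shift 0 j ω, mark 0 j ω)) P := by
    have h1 := (iIndepFun_shift_mark hNS).precomp (g := fun j : Fin n => ((0 : ℕ), (j : ℕ)))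
      fun i j hij => Fin.ext (Prod.ext_iff.1 hij).2
    exact h1.comp (fun _ (z : Plane × ℝ) => (y + z.1, z.2)) fun _ => by fun_prop
  have hsm : ∀ j : ℕ, IndepFun (shift 0 j) (mark 0 j) P := fun j =>
    hNS.shift_indep_mark.comp (φ := fun z : ℕ → ℕ → Plane => z 0 j)
      (ψ := fun z : ℕ → ℕ → ℝ => z 0 j) (by fun_prop)
      (by fun_prop)
  have hlaw : ∀ j : Fin n, P.map (fun ω => (y + shift 0 j ω, mark 0 j ω)) =
      ((volume.withDensity fun z => (k z : ℝ≥0∞)).map (y + ·)).prod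
        (volume.restrict (Icc (0 : ℝ) 1)) := by
    intro j
    have h1 := ((hsm j).comp (φ := (y + ·)) (ψ := id) (by fun_prop) measurable_id)
    have h2 := (indepFun_iff_map_prod_eq_prod_map_map ((hS 0 j).const_add y).aemeasurable
      (hM 0 j).aemeasurable).1 h1
    rw [h2, hNS.mark_law, ← hNS.shift_law 0 j, Measure.map_map (by fun_prop) (hS 0 j)]
    rfl
  have hprob : IsProbabilityMeasure (volume.withDensity fun z => (k z : ℝ≥0∞)) := by
    rw [← hNS.shift_law 0 0]
    exact Measure.isProbabilityMeasure_map (hS 0 0).aemeasurable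
  have hprob' : IsProbabilityMeasure ((volume.withDensity fun z => (k z : ℝ≥0∞)).map (y + ·)) :=
    Measure.isProbabilityMeasure_map (by fun_prop)
  rw [(iIndepFun_iff_map_fun_eq_pi_map fun j => (hm j).aemeasurable).1 hind]
  simp_rw [hlaw]
  -- Translation preserves Lebesgue measure, so the reference measure does not depend on `y`.
  refine absolutelyContinuous_pi (Measure.AbsolutelyContinuous.prod ?_ .rfl) n
  have h1 := (withDensity_absolutelyContinuous (volume : Measure Plane)
    (fun z => (k z : ℝ≥0∞))).map (measurable_const_add y)
  rwa [map_add_left_eq_self (volume : Measure Plane)] at h1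

/-- A measure dominating the law of the observation with an additional cluster, simultaneously for
all positions of its parent. -/
def dominatingMeasure (P : Measure Ω) (p : Plane → ℝ≥0) (Z : Ω → Measure Plane) (W : Set Plane) :
    Measure (Measure Plane) :=
  Measure.sum fun n : ℕ =>
    (P.prod (Measure.pi fun _ : Fin n =>
      (volume : Measure Plane).prod (volume.restrict (Icc (0 : ℝ) 1)))).map
        fun q => Z q.1 + (cluster p 0 (n, extendSeq 0 q.2)).restrict W

instance [SFinite P] (Z : Ω → Measure Plane) : SFinite (dominatingMeasure P p Z W) := by
  unfold dominatingMeasure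
  infer_instance

lemma measurable_add_cluster (hp : Measurable p) (hW : MeasurableSet W) {Z : Ω → Measure Plane}
    (hZ : Measurable Z) (n : ℕ) : Measurable fun q : Ω × (Fin n → Plane × ℝ) =>
      Z q.1 + (cluster p 0 (n, extendSeq 0 q.2)).restrict W := by
  have h0 : Measurable fun q : Ω × (Fin n → Plane × ℝ) => extendSeq (0 : Plane × ℝ) q.2 :=
    (measurable_extendSeq 0 n).comp measurable_snd
  exact measurable_add_measure (η := fun q : Ω × (Fin n → Plane × ℝ) => Z q.1) (by fun_prop)
    (measurable_restrict_comp ((measurable_cluster hp).comp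
      (f := fun q : Ω × (Fin n → Plane × ℝ) =>
        ((0 : Plane), ((n : ℕ), extendSeq (0 : Plane × ℝ) q.2))) (by fun_prop)) hW)

lemma map_add_cluster_absolutelyContinuous [IsProbabilityMeasure P]
    (hNS : IsNeymanScott P κ μ k parent number shift mark)
    (hp : Measurable p) (hW : MeasurableSet W) {Z : Ω → Measure Plane} (hZ : Measurable Z)
    (y : Plane) :
    (P.prod P).map (fun q => Z q.1 +
      (cluster p y (clusterVar number shift mark 0 q.2)).restrict W) ≪
        dominatingMeasure P p Z W := by
  refine Measure.AbsolutelyContinuous.mk fun G hG h0 => ?_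
  rw [dominatingMeasure, Measure.sum_apply _ hG, ENNReal.tsum_eq_zero] at h0
  have hC := measurable_cluster_clusterVar hNS hp hW
  have hm : Measurable fun q : Ω × Ω => Z q.1 +
      (cluster p y (clusterVar number shift mark 0 q.2)).restrict W :=
    measurable_add_measure (η := fun q : Ω × Ω => Z q.1)
      (ζ := fun q : Ω × Ω => (cluster p y (clusterVar number shift mark 0 q.2)).restrict W)
      (by fun_prop) (hC.comp (f := fun q : Ω × Ω => (q.2, y)) (by fun_prop))
  rw [Measure.map_apply hm hG]
  have hX : ∀ n, Measurable fun ω (j : Fin n) => (y + shift 0 j ω, mark 0 j ω) := fun n =>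
    measurable_pi_lambda _ fun j =>
      ((hNS.measurable_shift 0 j).const_add y).prodMk (hNS.measurable_mark 0 j)
  -- The actual number of offspring is one of countably many `n`, so it is enough that the event is
  -- null for each deterministic `n`.
  refine measure_mono_null (t := ⋃ n, (fun q : Ω × Ω =>
    (q.1, fun j : Fin n => (y + shift 0 j q.2, mark 0 j q.2))) ⁻¹'
      ((fun q : Ω × (Fin n → Plane × ℝ) =>
        Z q.1 + (cluster p 0 (n, extendSeq 0 q.2)).restrict W) ⁻¹' G)) (fun q hq => ?_)
    (measure_iUnion_null fun n => ?_)
  · refine mem_iUnion.2 ⟨number 0 q.2, ?_⟩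
    simp only [mem_preimage, clusterVar] at hq ⊢
    rwa [cluster_eq_extendSeq] at hq
  · have hG' := measurable_add_cluster hp hW hZ n hG
    have h1 := h0 n
    rw [Measure.map_apply (measurable_add_cluster hp hW hZ n) hG] at h1
    have hac : P.prod (P.map fun ω (j : Fin n) => (y + shift 0 j ω, mark 0 j ω)) ≪
      P.prod (Measure.pi fun _ : Fin n =>
        (volume : Measure Plane).prod (volume.restrict (Icc (0 : ℝ) 1))) :=
      Measure.AbsolutelyContinuous.rfl.prod (map_points_absolutelyContinuous hNS y n)
    have h2 := hac h1
    have h3 := Measure.map_prod_map P P measurable_id (hX n)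
    rw [Measure.map_id] at h3
    rw [h3, Measure.map_apply (measurable_id.prodMap (hX n)) hG'] at h2
    exact h2

/-- The parents have a conditional intensity given the observation. -/
lemma exists_isConditionalIntensity_parentProcess [IsProbabilityMeasure P]
    (hNS : IsNeymanScott P κ μ k parent number shift mark)
    (hk : Measurable k) (hp : Measurable p) (hp_le : ∀ x, p x ≤ 1)
    (hW : MeasurableSet W) (hA : MeasurableSet A) :
    ∃ ρ : Measure Plane → Plane → ℝ≥0∞,
      Measurable (fun q : Measure Plane × Plane => ρ q.1 q.2) ∧
      IsConditionalIntensity P (parentProcess parent)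
        (fun ω => (thinnedProcess p parent number shift mark ω).restrict W) A ρ := by
  have hZ := measurable_restrict_comp (measurable_thinnedProcess hNS hp) hW
  have hC := measurable_cluster_clusterVar hNS hp hW
  have hm : ∀ B : Set Plane, MeasurableSet B → ∀ F : Set (Measure Plane), MeasurableSet F →
      jointLaw P ((κ : ℝ≥0∞) • (volume : Measure Plane).restrict A)
        (fun ω => (thinnedProcess p parent number shift mark ω).restrict W)
        (fun q => (cluster p q.2 (clusterVar number shift mark 0 q.1)).restrict W) (F ×ˢ B) =
      ∫⁻ ω in (fun ω => (thinnedProcess p parent number shift mark ω).restrict W) ⁻¹' F,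
        parentProcess parent ω (B ∩ A) ∂P := fun B hB F hF =>
    prod_apply_eq_of_finite_sets hNS.parent_law.measurable hA
      (fun B hB hBf => jointLaw_cluster_apply hNS hk hp hp_le hW hA hB hBf hF) hB
  have hs : SFinite (jointLaw P ((κ : ℝ≥0∞) • (volume : Measure Plane).restrict A)
      (fun ω => (thinnedProcess p parent number shift mark ω).restrict W)
      (fun q => (cluster p q.2 (clusterVar number shift mark 0 q.1)).restrict W)) := by
    unfold jointLaw
    infer_instance
  have := Measure.isProbabilityMeasure_map (μ := P) hZ.aemeasurable
  refine exists_isConditionalIntensity hZ hA _ hm (absolutelyContinuous_prod_of_fst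
    (R := dominatingMeasure P p
      (fun ω => (thinnedProcess p parent number shift mark ω).restrict W) W) ?_ ?_)
  · refine (jointLaw_absolutelyContinuous hZ hC
      (map_add_cluster_absolutelyContinuous hNS hp hW hZ)).trans ?_
    exact Measure.AbsolutelyContinuous.rfl.prod (Measure.smul_absolutelyContinuous)
  -- The first marginal is `F ↦ E[1_F(Z) Ψ(A)]`, which vanishes on null sets of the law of `Z`.
  · refine Measure.AbsolutelyContinuous.mk fun F hF h0 => ?_
    rw [Measure.map_apply hZ hF] at h0
    rw [Measure.map_apply measurable_fst hF, ← prod_univ, hm _ MeasurableSet.univ F hF]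
    exact setLIntegral_measure_zero _ _ h0

end NeymanScott

end

/-! ### The conditional intensity of the offspring outside the window. -/

section

variable {p k : Plane → ℝ≥0} {Ω : Type*} [MeasurableSpace Ω] {P : Measure Ω}
  {κ μ : ℝ≥0}
  {parent : ℕ → Ω → Plane} {number : ℕ → Ω → ℕ} {shift : ℕ → ℕ → Ω → Plane}
  {mark : ℕ → ℕ → Ω → ℝ} {W : Set Plane} {r : ℝ}

/-- Restrictions of a point process with measurably enumerated points have regular conditional
laws. -/
lemma exists_hasCondDistrib_parentProcess [IsFiniteMeasure P] {T : Type*} [MeasurableSpace T]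
    (hparent : ∀ i, Measurable (parent i)) {Z : Ω → T} (hZ : Measurable Z) {A : Set Plane}
    (hA : MeasurableSet A) :
    ∃ K : Kernel T (Measure Plane), IsMarkovKernel K ∧
      HasCondDistrib (fun ω => (parentProcess parent ω).restrict A) Z K P := by
  have hX : Measurable fun ω i => parent i ω := measurable_pi_lambda _ hparent
  -- The conditional law is taken for the sequence of parents, which lives in a Polish space, and
  -- pushed forward to the restricted configuration.
  have h : HasCondDistrib (fun ω i => parent i ω) Z (condDistrib (fun ω i => parent i ω) Z P) P :=
    ⟨(hZ.prodMk hX).aemeasurable, (compProd_map_condDistrib hX.aemeasurable).symm⟩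
  have hf : Measurable fun s : ℕ → Plane =>
      (Measure.sum fun i => Measure.dirac (s i)).restrict A :=
    measurable_restrict_comp (measurable_measure_sum (m := fun i (s : ℕ → Plane) =>
      Measure.dirac (s i)) fun i => Measure.measurable_dirac.comp (measurable_pi_apply i)) hA
  exact ⟨_, Kernel.IsMarkovKernel.map _ hf, h.comp_left hf⟩

lemma outerTerm_eq (hk_supp : ∀ z, r < ‖z‖ → k z = 0) {A : Set Plane} (hA : MeasurableSet A)
    (x : Plane) :
    outerTerm κ μ k p r A x = μ * κ * ∫⁻ y in Aᶜ, (p x : ℝ≥0∞) * k (y - x) := by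
  rw [outerTerm, ← lintegral_indicator (Metric.isClosed_closedBall.measurableSet.diff hA),
    ← lintegral_indicator hA.compl]
  congr 1
  refine lintegral_congr fun y => ?_
  by_cases hy : y ∈ A
  · rw [indicator_of_notMem (notMem_sdiff_of_mem hy), indicator_of_notMem (notMem_compl_iff.2 hy)]
  by_cases hyx : y ∈ Metric.closedBall x r
  · rw [indicator_of_mem (mem_sdiff_of_mem hyx hy), indicator_of_mem (mem_compl hy)]
  · rw [indicator_of_notMem fun h : y ∈ Metric.closedBall x r \ A => hyx h.1,
      indicator_of_mem (mem_compl hy), hk_supp (y - x)]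
    · simp
    · rwa [mem_closedBall_iff_norm, not_le] at hyx

/-- Tonelli with evenness of `k`: the intensity formula has the offspring location fixed, the
dispersed function has the parent fixed. -/
lemma setLIntegral_kernel_eq_disperse (hk : Measurable k) (hk_even : ∀ z, k (-z) = k z)
    (hp : Measurable p) {B A : Set Plane} (hB : MeasurableSet B) {f : Plane → ℝ≥0∞}
    (hf : Measurable f) :
    ∫⁻ x in B, ∫⁻ y in A, (μ : ℝ≥0∞) * p x * k (y - x) * f y =
      ∫⁻ y in A, (μ * disperse k p (B.indicator 1) y) * f y := by
  rw [lintegral_lintegral_swap (by fun_prop)]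
  refine lintegral_congr fun y => ?_
  rw [disperse, ← lintegral_const_mul' _ _ ENNReal.coe_ne_top,
    ← lintegral_mul_const _ (by
      have : Measurable (B.indicator (1 : Plane → ℝ≥0∞)) := measurable_one.indicator hB
      fun_prop), ← lintegral_indicator hB]
  refine lintegral_congr fun x => ?_
  have hxy : k (x - y) = k (y - x) := by rw [← hk_even, neg_sub]
  by_cases hx : x ∈ B
  · simp only [indicator_of_mem hx, Pi.one_apply, hxy]; ring
  · simp only [indicator_of_notMem hx, mul_zero, zero_mul]

/-- The conditional intensity of the offspring outside `W`, through a measurable conditional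
intensity of the parents. -/
lemma isConditionalIntensity_thinnedProcess [IsProbabilityMeasure P]
    (hNS : IsNeymanScott P κ μ k parent number shift mark)
    (hk : Measurable k) (hk_int : ∫⁻ z, (k z : ℝ≥0∞) = 1) (hk_supp : ∀ z, r < ‖z‖ → k z = 0)
    (hk_even : ∀ z, k (-z) = k z) (hp : Measurable p) (hp_le : ∀ x, p x ≤ 1)
    (hW : MeasurableSet W) (hA : MeasurableSet (W ∪ border W r))
    {ρ : Measure Plane → Plane → ℝ≥0∞}
    (hρm : Measurable fun q : Measure Plane × Plane => ρ q.1 q.2)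
    (hρ : IsConditionalIntensity P (parentProcess parent)
      (fun ω => (thinnedProcess p parent number shift mark ω).restrict W) (W ∪ border W r) ρ) :
    IsConditionalIntensity P (thinnedProcess p parent number shift mark)
      (fun ω => (thinnedProcess p parent number shift mark ω).restrict W) Wᶜ
      (fun φ x => (∫⁻ y in W ∪ border W r, (μ : ℝ≥0∞) * p x * k (y - x) * ρ φ y) +
        outerTerm κ μ k p r (W ∪ border W r) x) := by
  have hΦ := measurable_thinnedProcess hNS hp
  have hZ := measurable_restrict_comp hΦ hW
  -- This auxiliary conditional law only serves to exchange the sum over parents for an integral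
  -- against `ρ`.
  obtain ⟨K, _, hK⟩ := exists_hasCondDistrib_parentProcess (P := P) hNS.measurable_parent hZ hA
  have hcond := lintegral_condLaw_eq hZ hA
    (fun B hB hBf => lintegral_parentProcess_ne_top hNS hB hBf) hK hρ
  generalize hAe : W ∪ border W r = A at *
  have hm : Measurable fun q : Measure Plane × Plane =>
      (∫⁻ y in A, (μ : ℝ≥0∞) * p q.2 * k (y - q.2) * ρ q.1 y) + outerTerm κ μ k p r A q.2 := by
    simp_rw [outerTerm_eq hk_supp hA]
    have h1 : Measurable fun q : (Measure Plane × Plane) × Plane =>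
        (μ : ℝ≥0∞) * p q.1.2 * k (q.2 - q.1.2) * ρ q.1.1 q.2 := by
      have : Measurable fun q : (Measure Plane × Plane) × Plane => ρ q.1.1 q.2 :=
        hρm.comp (f := fun q : (Measure Plane × Plane) × Plane => (q.1.1, q.2)) (by fun_prop)
      fun_prop
    have h2 : Measurable fun q : (Measure Plane × Plane) × Plane =>
        (p q.1.2 : ℝ≥0∞) * k (q.2 - q.1.2) := by fun_prop
    exact h1.lintegral_prod_right'.add (h2.lintegral_prod_right'.const_mul _)
  rw [isConditionalIntensity_iff hZ hW.compl]
  refine ⟨hm.aemeasurable, fun B hB F hF =>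
    prod_apply_eq_of_finite_sets hΦ hW.compl (fun B hB hBf => ?_) hB⟩
  refine (withDensity_prod_apply (lam := fun φ x => (∫⁻ y in A, (μ : ℝ≥0∞) * p x * k (y - x) *
    ρ φ y) + outerTerm κ μ k p r A x) hZ hm.aemeasurable hF hB).trans ?_
  have hBW := hB.inter hW.compl
  have hf : Measurable ((B ∩ Wᶜ).indicator (1 : Plane → ℝ≥0∞)) := measurable_one.indicator hBW
  have hg : Measurable fun y => μ * disperse k p ((B ∩ Wᶜ).indicator 1) y :=
    (measurable_disperse hp hk hf).const_mul _
  have hpart := setLIntegral_thinnedProcess hNS hk hk_int hk_supp hk_even hp hp_le hW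
    (hAe ▸ hA) hBW ((measure_mono inter_subset_left).trans_lt hBf.lt_top).ne inter_subset_right hF
  rw [hAe] at hpart
  have hρφ : ∀ φ, Measurable (ρ φ) := fun φ => hρm.comp measurable_prodMk_left
  have hinner : ∀ φ, ∫⁻ x in B ∩ Wᶜ, ((∫⁻ y in A, (μ : ℝ≥0∞) * p x * k (y - x) * ρ φ y) +
      outerTerm κ μ k p r A x) = (∫⁻ y in A, μ * disperse k p ((B ∩ Wᶜ).indicator 1) y * ρ φ y) +
        κ * ∫⁻ y in Aᶜ, μ * disperse k p ((B ∩ Wᶜ).indicator 1) y := by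
    intro φ
    have hρφ := hρφ φ
    have h1 : Measurable fun x => ∫⁻ y in A, (μ : ℝ≥0∞) * p x * k (y - x) * ρ φ y := by
      have : Measurable fun q : Plane × Plane => (μ : ℝ≥0∞) * p q.1 * k (q.2 - q.1) * ρ φ q.2 := by
        fun_prop
      exact this.lintegral_prod_right'
    have h2 : Measurable fun x => ∫⁻ y in Aᶜ, (μ : ℝ≥0∞) * p x * k (y - x) * 1 := by
      have : Measurable fun q : Plane × Plane => (μ : ℝ≥0∞) * p q.1 * k (q.2 - q.1) * 1 := by
        fun_prop
      exact this.lintegral_prod_right'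
    have h3 : ∀ x, outerTerm κ μ k p r A x =
        κ * ∫⁻ y in Aᶜ, (μ : ℝ≥0∞) * p x * k (y - x) * 1 := by
      intro x
      rw [outerTerm_eq hk_supp hA, mul_comm (μ : ℝ≥0∞), mul_assoc,
        ← lintegral_const_mul' _ _ ENNReal.coe_ne_top]
      simp only [mul_assoc, mul_one]
    simp_rw [h3]
    rw [lintegral_add_left h1, lintegral_const_mul _ h2,
      setLIntegral_kernel_eq_disperse hk hk_even hp hBW hρφ,
      setLIntegral_kernel_eq_disperse hk hk_even hp hBW measurable_const]
    simp only [mul_one]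
  simp only [hinner]
  rw [hpart]
  have h1 : Measurable fun φ => ∫⁻ y in A, μ * disperse k p ((B ∩ Wᶜ).indicator 1) y * ρ φ y := by
    have : Measurable fun q : Measure Plane × Plane =>
        μ * disperse k p ((B ∩ Wᶜ).indicator 1) q.2 * ρ q.1 q.2 :=
      (hg.comp measurable_snd).mul hρm
    exact this.lintegral_prod_right'
  rw [lintegral_add_right _ measurable_const, lintegral_add_right _ measurable_const]
  congr 1
  have h2 := setLIntegral_lintegral_of_hasCondDistrib hZ hK
    (g := fun ψ => ∫⁻ y in A, μ * disperse k p ((B ∩ Wᶜ).indicator 1) y ∂ψ)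
    (by simp_rw [← lintegral_indicator hA]
        exact Measure.measurable_lintegral (hg.indicator hA)) hF
  simp only [Measure.restrict_restrict hA, inter_self] at h2
  rw [← h2, setLIntegral_preimage_eq_map hZ (g := fun φ =>
    ∫⁻ y in A, μ * disperse k p ((B ∩ Wᶜ).indicator 1) y * ρ φ y) h1.aemeasurable hF]
  refine lintegral_congr_ae (ae_restrict_of_ae ?_)
  filter_upwards [hcond] with φ hφ
  exact (hφ _ hg).symm

end

end ClusterProcess

end

theorem proposition1 {Ω : Type*} [MeasurableSpace Ω] (P : Measure Ω) [IsProbabilityMeasure P]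
    (κ μ : ℝ≥0) (hκ : 0 < κ) (r : ℝ)
    -- the dispersion kernel: an even probability density supported in the disc of radius `r`
    (k : ClusterProcess.Plane → ℝ≥0) (hk_meas : Measurable k)
    (hk_int : ∫⁻ z, (k z : ℝ≥0∞) = 1) (hk_supp : ∀ z, r < ‖z‖ → k z = 0)
    (hk_even : ∀ z, k (-z) = k z)
    -- the retention probability
    (p : ClusterProcess.Plane → ℝ≥0) (hp_meas : Measurable p) (hp_le : ∀ x, p x ≤ 1)
    -- the Neyman–Scott process and its thinning
    (parent : ℕ → Ω → ClusterProcess.Plane) (number : ℕ → Ω → ℕ)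
    (shift : ℕ → ℕ → Ω → ClusterProcess.Plane) (mark : ℕ → ℕ → Ω → ℝ)
    (hNS : ClusterProcess.IsNeymanScott P κ μ k parent number shift mark)
    (Ψ Φ : Ω → Measure ClusterProcess.Plane)
    (hΨ : Ψ = ClusterProcess.parentProcess parent)
    (hΦ : Φ = ClusterProcess.thinnedProcess p parent number shift mark)
    -- the observation window `W`, the region `A = W ∪ ∂W` and the observation `Φ_W`
    (W : Set ClusterProcess.Plane) (hW : MeasurableSet W)
    (hW_border : MeasurableSet (ClusterProcess.border W r))
    (A : Set ClusterProcess.Plane) (hA : A = W ∪ ClusterProcess.border W r)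
    (ΦW : Ω → Measure ClusterProcess.Plane) (hΦW : ΦW = fun ω => (Φ ω).restrict W) :
    -- there is a regular conditional law of `Ψ_{W ∪ ∂W}` given `Φ_W`
    (∃ K : Kernel (Measure ClusterProcess.Plane) (Measure ClusterProcess.Plane),
      IsMarkovKernel K ∧ HasCondDistrib (fun ω => (Ψ ω).restrict A) ΦW K P) ∧
    -- there is a conditional intensity of the parents in `W ∪ ∂W` given `Φ_W`
    (∃ ρ : Measure ClusterProcess.Plane → ClusterProcess.Plane → ℝ≥0∞,
      ClusterProcess.IsConditionalIntensity P Ψ ΦW A ρ) ∧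
    ∀ K : Kernel (Measure ClusterProcess.Plane) (Measure ClusterProcess.Plane),
      IsMarkovKernel K → HasCondDistrib (fun ω => (Ψ ω).restrict A) ΦW K P →
      -- the formula is a conditional intensity of `Φ` outside `W` given `Φ_W`
      ClusterProcess.IsConditionalIntensity P Φ ΦW Wᶜ
        (fun φ x => ∫⁻ ψ, (ClusterProcess.parentSum μ k p A ψ x +
          ClusterProcess.outerTerm κ μ k p r A x) ∂(K φ)) ∧
      -- and it is the only one, up to null sets
      (∀ lam : Measure ClusterProcess.Plane → ClusterProcess.Plane → ℝ≥0∞,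
        ClusterProcess.IsConditionalIntensity P Φ ΦW Wᶜ lam →
        ∀ᵐ φ ∂(P.map ΦW), ∀ᵐ x ∂(volume.restrict Wᶜ),
          lam φ x = ∫⁻ ψ, (ClusterProcess.parentSum μ k p A ψ x +
            ClusterProcess.outerTerm κ μ k p r A x) ∂(K φ)) ∧
      -- rewriting of the first part through the conditional parent intensity
      (∀ ρ : Measure ClusterProcess.Plane → ClusterProcess.Plane → ℝ≥0∞,
        ClusterProcess.IsConditionalIntensity P Ψ ΦW A ρ →
        (∀ᵐ φ ∂(P.map ΦW), ∀ x,
          ∫⁻ ψ, ClusterProcess.parentSum μ k p A ψ x ∂(K φ) =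
            ∫⁻ y in A, (μ : ℝ≥0∞) * p x * k (y - x) * ρ φ y) ∧
        ClusterProcess.IsConditionalIntensity P Φ ΦW Wᶜ
          (fun φ x => (∫⁻ y in A, (μ : ℝ≥0∞) * p x * k (y - x) * ρ φ y) +
            ClusterProcess.outerTerm κ μ k p r A x)) := by
  subst hΨ hΦ hA hΦW
  have hA : MeasurableSet (W ∪ ClusterProcess.border W r) := hW.union hW_border
  have hΦ := ClusterProcess.measurable_thinnedProcess hNS hp_meas
  have hZ := ClusterProcess.measurable_restrict_comp hΦ hW
  have hfinΨ := fun B hB hBf => ClusterProcess.lintegral_parentProcess_ne_top hNS (B := B) hB hBf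
  -- A jointly measurable version is chosen to establish the formula. Other versions are only almost
  -- everywhere measurable and are reached through `K`.
  obtain ⟨ρ₀, hρ₀m, hρ₀⟩ := ClusterProcess.exists_isConditionalIntensity_parentProcess hNS hk_meas
    hp_meas hp_le hW hA
  refine ⟨ClusterProcess.exists_hasCondDistrib_parentProcess hNS.measurable_parent hZ hA,
    ⟨ρ₀, hρ₀⟩, fun K _ hK => ?_⟩
  have hsum : ∀ ρ : Measure ClusterProcess.Plane → ClusterProcess.Plane → ℝ≥0∞,
      ClusterProcess.IsConditionalIntensity P (ClusterProcess.parentProcess parent) _ _ ρ →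
      ∀ᵐ φ ∂(P.map _), ∀ x, _ := fun ρ hρ => by
    filter_upwards [ClusterProcess.lintegral_condLaw_eq hZ hA hfinΨ hK hρ] with φ hφ x
    exact hφ (fun y => (μ : ℝ≥0∞) * p x * k (y - x)) (by fun_prop)
  have hadd : ∀ φ x, ∫⁻ ψ, (ClusterProcess.parentSum μ k p (W ∪ ClusterProcess.border W r) ψ x +
      ClusterProcess.outerTerm κ μ k p r (W ∪ ClusterProcess.border W r) x) ∂(K φ) =
      ∫⁻ ψ, ClusterProcess.parentSum μ k p (W ∪ ClusterProcess.border W r) ψ x ∂(K φ) +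
        ClusterProcess.outerTerm κ μ k p r (W ∪ ClusterProcess.border W r) x := by
    intro φ x
    rw [lintegral_add_right _ measurable_const, lintegral_const, measure_univ, mul_one]
  -- For almost every observation the two expressions agree at all `x`, so the intensity property
  -- passes from `ρ₀` to `K`, and below from `K` to any `ρ`.
  have hmain := (ClusterProcess.isConditionalIntensity_thinnedProcess hNS hk_meas hk_int hk_supp
    hk_even hp_meas hp_le hW hA hρ₀m hρ₀).congr (lam' := fun φ x =>
      ∫⁻ ψ, (ClusterProcess.parentSum μ k p (W ∪ ClusterProcess.border W r) ψ x +
        ClusterProcess.outerTerm κ μ k p r (W ∪ ClusterProcess.border W r) x) ∂(K φ))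
    hZ hW.compl (by
      filter_upwards [hsum ρ₀ hρ₀] with φ hφ x
      rw [hadd, ← hφ x]
      rfl)
  refine ⟨hmain, fun lam hlam => hlam.ae_eq hZ hW.compl
    (fun B hB hBf => ClusterProcess.lintegral_thinnedProcess_ne_top hNS hk_meas hk_int hk_even
      hp_meas hp_le hB hBf) hmain, fun ρ hρ => ⟨hsum ρ hρ, hmain.congr hZ hW.compl ?_⟩⟩
  filter_upwards [hsum ρ hρ] with φ hφ x
  rw [hadd, ← hφ x]
  rfl
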